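/- **Binary value principle modulo $p$.** There is a polynomial $Q$ with natural-number coefficients such that the following holds for every prime $p$, every $n\ge 0$ and every algebraic circuit $F(x_1,\dots,x_n)$ over $\mathbb{F}_p$ of total bit-size $s$. Put $b_p=\lfloor\log_2 p\rfloor+1$ and, for each $i$, let $x_{i,0},\dots,x_{i,b_p-1}$ be new variables. Then there is an $\mathrm{IPS}_{\mathbb{F}_p}$ proof of total bit-size at most $Q(s+\lfloor\log_2 p\rfloor)$, from the Boolean axioms $x_{i,j}^2-x_{i,j}$ ($1\le i\le n$, $0\le j<b_p$), of the polynomial $$F\bigl(\mathrm{VAL}_p(\overline{\mathrm{BIT}}_p(x_1)),\dots,\mathrm{VAL}_p(\overline{\mathrm{BIT}}_p(x_n))\bigr)-\mathrm{VAL}_p(\overline{\mathrm{BIT}}_p(F)).$$ *Circuits and IPS.* An algebraic circuit over a ring $R$ is a directed acyclic graph with an output gate, whose gates are variables, constants, binary products, linear combinations of any fan-in with wires labelled by elements of $R$, and inversions of syntactically constant gates with invertible value. Its total bit-size is the number of gates, plus the number of wires, plus the binary lengths of all constants that label gates or wires, elements of $\mathbb{F}_p$ being written as integers in $\{0,\dots,p-1\}$.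 An $\mathrm{IPS}_R$ proof of $G(\overline x)$ from polynomials $A_1,\dots,A_m$ is an algebraic circuit over $R$ that computes a polynomial $C(\overline x,y_1,\dots,y_m)$ with $C(\overline x,A_1,\dots,A_m)=G$ and $C(\overline x,\overline 0)=0$. *Values.* Boolean circuits are identified with polynomials through $\mathrm{alg}(x)=x$, $\mathrm{alg}(0)=0$, $\mathrm{alg}(1)=1$, $\mathrm{alg}(\neg\varphi)=1-\mathrm{alg}(\varphi)$, $\mathrm{alg}(\varphi\wedge\psi)=\mathrm{alg}(\varphi)\mathrm{alg}(\psi)$, $\mathrm{alg}(\varphi\vee\psi)=1-(1-\mathrm{alg}(\varphi))(1-\mathrm{alg}(\psi))$. For a vector $\overline z=(z_0,\dots,z_{b-1})$ of Boolean circuits, $\mathrm{VAL}_p(\overline z)=\sum_{i<b}2^i\,\mathrm{alg}(z_i)\in\mathbb{F}_p[x_{i,j}]$. *Arithmetic modulo $p$.* Let $\mathrm{ADD}$ and $\mathrm{PROD}$ be the ripple-carry adder and the shift-and-add multiplier, for unsigned binary numbers or, in the definition of $\mathrm{SUB}$, for two's complement. For an unsigned $b$-bit vector $\overline z$, let $\mathrm{LT}_i(\overline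 z)$ be the bitwise comparison circuit for $\overline z<2^ip$, and let $\mathrm{SUB}_i(\overline z)=\mathrm{ADD}(0\overline z,\mathrm{PROD}(-2^i,p))$ be the two's-complement circuit for $\overline z-2^ip$. Put $\overline z^{\,0}=\overline z$ and, for $1\le i\le b$ and $0\le j<b$, $$z^{\,i}_j=\bigl(\mathrm{LT}_{b-i}(\overline z^{\,i-1})\wedge z^{\,i-1}_j\bigr)\vee\bigl(\neg\mathrm{LT}_{b-i}(\overline z^{\,i-1})\wedge \mathrm{SUB}_{b-i}(\overline z^{\,i-1})_j\bigr).$$ Let $\overline{\mathrm{REM}}_p(\overline z)$ consist of the $b_p$ lowest bits of $\overline z^{\,b}$, and put $\overline{\mathrm{ADD}}_p=\overline{\mathrm{REM}}_p\circ\mathrm{ADD}$ and $\overline{\mathrm{PROD}}_p=\overline{\mathrm{REM}}_p\circ\mathrm{PROD}$ on pairs of unsigned $b_p$-bit vectors. *Bit extraction.* $\overline{\mathrm{BIT}}_p$ is defined along the gates of $F$: $\overline{\mathrm{BIT}}_p(x_i)=(x_{i,0},\dots,x_{i,b_p-1})$; for $\alpha\in\mathbb{F}_p$, $\overline{\mathrm{BIT}}_p(\alpha)$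 is the vector of the $b_p$ binary digits of $\alpha\in\{0,\dots,p-1\}$; $\overline{\mathrm{BIT}}_p(G\times H)=\overline{\mathrm{PROD}}_p(\overline{\mathrm{BIT}}_p(G),\overline{\mathrm{BIT}}_p(H))$; $\overline{\mathrm{BIT}}_p(G+H)=\overline{\mathrm{ADD}}_p(\overline{\mathrm{BIT}}_p(G),\overline{\mathrm{BIT}}_p(H))$. A linear combination $\sum_i c_iG_i$ is treated as the iterated sum $c_1G_1+(c_2G_2+\cdots)$, where the bits of $c_iG_i$ are those of $G_i$ if $c_i=1$ and those of the product $c_i\times G_i$ otherwise, and the empty sum is the constant $0$; an inversion gate is treated as the constant it computes. -/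

import Mathlib

/-! ## Algebraic circuits -/

namespace AlgCirc

/-- A gate of an algebraic circuit over `R` with variables in `V`, whose incoming wires start at
some of the `k` gates that precede it: a variable, a constant, a binary product, a linear
combination of arbitrary fan-in with its wires labelled by elements of `R`, or an inversion. -/
inductive Gate (R V : Type) (k : ℕ) : Type
  | var (v : V) : Gate R V k
  | const (c : R) : Gate R V k
  | mul (u w : Fin k) : Gate R V k
  | lin (l : List (R × Fin k)) : Gate R V k
  | inv (u : Fin k) : Gate R V k

/-- The gates of an acyclic circuit, listed in a topological order. A gate may be reused by any
number of later gates. -/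
inductive Gates (R V : Type) : ℕ → Type
  | nil : Gates R V 0
  | snoc {k : ℕ} (c : Gates R V k) (g : Gate R V k) : Gates R V (k + 1)

/-- A gate is syntactically constant if all the inputs it depends on are constants. -/
def Gate.SynConst {R V : Type} {k : ℕ} (s : Fin k → Prop) : Gate R V k → Prop
  | .var _ => False
  | .const _ => True
  | .mul u w => s u ∧ s w
  | .lin l => ∀ e ∈ l, s e.2
  | .inv u => s u

def Gates.SynConst {R V : Type} : {k : ℕ} → Gates R V k → Fin k → Prop
  | _, .nil => Fin.elim0
  | _, .snoc c g => Fin.snoc (α := fun _ => Prop) c.SynConst (g.SynConst c.SynConst)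

/-- The polynomial computed at a gate, from the polynomials `f` computed at its predecessors. -/
noncomputable def Gate.poly {R V : Type} [CommRing R] {k : ℕ} (f : Fin k → MvPolynomial V R) :
    Gate R V k → MvPolynomial V R
  | .var v => MvPolynomial.X v
  | .const c => MvPolynomial.C c
  | .mul u w => f u * f w
  | .lin l => (l.map fun e => MvPolynomial.C e.1 * f e.2).sum
  | .inv u => Ring.inverse (f u)

noncomputable def Gates.poly {R V : Type} [CommRing R] :
    {k : ℕ} → Gates R V k → Fin k → MvPolynomial V R
  | _, .nil => Fin.elim0
  | _, .snoc c g => Fin.snoc (α := fun _ => MvPolynomial V R) c.poly (g.poly c.poly)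

/-- Inversion is allowed only at syntactically constant gates whose value is invertible. -/
def Gate.Admissible {R V : Type} [CommRing R] {k : ℕ} (c : Gates R V k) : Gate R V k → Prop
  | .inv u => c.SynConst u ∧ IsUnit (c.poly u)
  | _ => True

def Gates.Admissible {R V : Type} [CommRing R] : {k : ℕ} → Gates R V k → Prop
  | _, .nil => True
  | _, .snoc c g => c.Admissible ∧ g.Admissible c

/-- The contribution of a gate to the total bit-size: one for the gate, one for each incoming
wire, and the length of the binary representation of each constant that labels the gate or one of
its wires, elements of `𝔽_p` being written as elements of `{0, …, p - 1}`. -/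
def Gate.bitSize {p : ℕ} {V : Type} {k : ℕ} : Gate (ZMod p) V k → ℕ
  | .var _ => 1
  | .const c => 1 + c.val.size
  | .mul _ _ => 1 + 2
  | .lin l => 1 + (l.map fun e => 1 + e.1.val.size).sum
  | .inv _ => 1 + 1

def Gates.bitSize {p : ℕ} {V : Type} : {k : ℕ} → Gates (ZMod p) V k → ℕ
  | _, .nil => 0
  | _, .snoc c g => c.bitSize + g.bitSize

end AlgCirc

/-- An algebraic circuit over `R` with variables in `V` and one output gate. -/
structure AlgCircuit (R V : Type) [CommRing R] where
  numGates : ℕ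
  gates : AlgCirc.Gates R V numGates
  admissible : gates.Admissible
  out : Fin numGates

/-- The polynomial computed by a circuit. -/
noncomputable def AlgCircuit.poly {R V : Type} [CommRing R] (F : AlgCircuit R V) :
    MvPolynomial V R :=
  F.gates.poly F.out

/-- The total bit-size of a circuit over `𝔽_p`. -/
def AlgCircuit.bitSize {p : ℕ} {V : Type} (F : AlgCircuit (ZMod p) V) : ℕ :=
  F.gates.bitSize

/-! ## The Ideal Proof System -/

/-- `P` computes an IPS certificate `C(x, y)` of `G` from the polynomials `A a`; the variables `x`
are the `Sum.inl v` and the placeholder of `A a` is `Sum.inr a`. -/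
def IsIPSProof {R V K : Type} [CommRing R] (P : AlgCircuit R (V ⊕ K)) (A : K → MvPolynomial V R)
    (G : MvPolynomial V R) : Prop :=
  MvPolynomial.aeval (Sum.elim MvPolynomial.X A) P.poly = G ∧
  MvPolynomial.aeval (Sum.elim (MvPolynomial.X (R := R) (σ := V)) (fun _ : K => 0)) P.poly = 0

/-- The Boolean axioms `v ^ 2 - v`, one for each variable. -/
noncomputable def boolAxiom (R V : Type) [CommRing R] (v : V) : MvPolynomial V R :=
  MvPolynomial.X v ^ 2 - MvPolynomial.X v

/-! ## Boolean circuits and their algebraic translation -/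

/-- Boolean circuits over the basis `¬, ∧, ∨`, identified with their unfolding: below, only the
polynomial that a Boolean circuit is translated to matters, and never its size. -/
inductive BoolCircuit (V : Type) : Type
  | var (v : V) : BoolCircuit V
  | const (b : Bool) : BoolCircuit V
  | not (a : BoolCircuit V) : BoolCircuit V
  | and (a b : BoolCircuit V) : BoolCircuit V
  | or (a b : BoolCircuit V) : BoolCircuit V

namespace BoolCircuit

variable {V : Type}

/-- The algebraic translation. -/
noncomputable def alg (R : Type) [CommRing R] : BoolCircuit V → MvPolynomial V R
  | var v => MvPolynomial.X v
  | const b => if b then 1 else 0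
  | not a => 1 - a.alg R
  | and a b => a.alg R * b.alg R
  | or a b => 1 - (1 - a.alg R) * (1 - b.alg R)

def xor (a b : BoolCircuit V) : BoolCircuit V :=
  or (and a (not b)) (and (not a) b)

/-! ### Binary arithmetic

Bit vectors are lists of Boolean circuits, least significant bit first. -/

/-- The `i`-th bit of an unsigned number; `0` beyond its length. -/
def ubit (x : List (BoolCircuit V)) (i : ℕ) : BoolCircuit V :=
  x.getD i (const false)

/-- The sign bit, that is the last bit, of a number in two's complement. -/
def sign (x : List (BoolCircuit V)) : BoolCircuit V :=
  x.getLastD (const false)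

/-- The `i`-th bit of a number in two's complement; the sign bit is repeated beyond its length. -/
def sbit (x : List (BoolCircuit V)) (i : ℕ) : BoolCircuit V :=
  x.getD i (sign x)

/-- The carry into position `i` in the addition of two numbers in two's complement. -/
def CARRY (x y : List (BoolCircuit V)) : ℕ → BoolCircuit V
  | 0 => const false
  | i + 1 => or (and (sbit x i) (sbit y i)) (and (or (sbit x i) (sbit y i)) (CARRY x y i))

/-- Addition in two's complement. Two numbers of `k` bits have a sum of `k + 1` bits. -/
def ADD (x y : List (BoolCircuit V)) : List (BoolCircuit V) :=
  (List.range (max x.length y.length + 1)).map fun i =>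
    xor (xor (sbit x i) (sbit y i)) (CARRY x y i)

/-- Addition of unsigned numbers: a sign bit `0` is prepended to both, and the sign bit of the sum
is dropped. Two numbers of `k` bits have a sum of `k + 1` bits. -/
def ADDplus (x y : List (BoolCircuit V)) : List (BoolCircuit V) :=
  (ADD (x ++ [const false]) (y ++ [const false])).dropLast

/-- The sum of the first `i` summands `2 ^ j * y_j * x` of the product of two unsigned numbers.
Adding `2 ^ i * y_i * x` leaves the `i` lowest bits unchanged. -/
def PRODplusAux (x y : List (BoolCircuit V)) : ℕ → List (BoolCircuit V)
  | 0 => List.replicate x.length (const false)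
  | i + 1 => (PRODplusAux x y i).take i ++
      ADDplus ((PRODplusAux x y i).drop i) (x.map fun a => and a (ubit y i))

/-- Product of unsigned numbers by shifting and adding. Numbers of `k` and `l` bits have a product
of `k + l` bits. -/
def PRODplus (x y : List (BoolCircuit V)) : List (BoolCircuit V) :=
  PRODplusAux x y y.length

/-- If `s = 0`, the number `x` in two's complement; if `s = 1`, its opposite: all bits are
flipped and `1` is added. -/
def NEGIF (s : BoolCircuit V) (x : List (BoolCircuit V)) : List (BoolCircuit V) :=
  ADD (x.map fun a => xor a s) [s, const false]

/-- The absolute value of a number in two's complement. -/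
def ABS (x : List (BoolCircuit V)) : List (BoolCircuit V) :=
  NEGIF (sign x) x

/-- Product in two's complement: the product of the absolute values, with the appropriate sign. -/
def PROD (x y : List (BoolCircuit V)) : List (BoolCircuit V) :=
  NEGIF (xor (sign x) (sign y)) (PRODplus (ABS x) (ABS y) ++ [const false])

/-- The `b` lowest bits of a natural number, as constants. -/
def natBits (b n : ℕ) : List (BoolCircuit V) :=
  (List.range b).map fun i => const (n.testBit i)

/-- The bits of an integer in two's complement, as constants. -/
def intBits (a : ℤ) : List (BoolCircuit V) :=
  (List.range (a.natAbs.size + 1)).map fun i => const (a.testBit i)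

/-- Comparison of the `i` lowest bits of two unsigned numbers. -/
def LTaux (x y : List (BoolCircuit V)) : ℕ → BoolCircuit V
  | 0 => const false
  | i + 1 => or (and (not (ubit x i)) (ubit y i))
      (and (not (xor (ubit x i) (ubit y i))) (LTaux x y i))

/-- The circuit that decides `x < y` for unsigned numbers. -/
def LT (x y : List (BoolCircuit V)) : BoolCircuit V :=
  LTaux x y (max x.length y.length)

/-- The circuit that decides `x < 2 ^ i * p` for an unsigned number `x`. -/
def LTp (p i : ℕ) (x : List (BoolCircuit V)) : BoolCircuit V :=
  LT x (natBits (2 ^ i * p).size (2 ^ i * p))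

/-- The number `x - 2 ^ i * p` in two's complement, for an unsigned number `x`. -/
def SUBPROD (p : ℕ) (x : List (BoolCircuit V)) (i : ℕ) : List (BoolCircuit V) :=
  ADD (x ++ [const false]) (PROD (intBits (-2 ^ i)) (intBits p))

/-- If `x < 2 ^ i * p` then `x`, else `x - 2 ^ i * p`. -/
def REMstep (p i : ℕ) (x : List (BoolCircuit V)) : List (BoolCircuit V) :=
  (List.range x.length).map fun j =>
    or (and (LTp p i x) (ubit x j)) (and (not (LTp p i x)) (sbit (SUBPROD p x i) j))

/-- The value after `i` iterations, for the exponents `b - 1, b - 2, …, b - i`, where `b` is the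
number of bits of `x`. -/
def REMiter (p : ℕ) (x : List (BoolCircuit V)) : ℕ → List (BoolCircuit V)
  | 0 => x
  | i + 1 => REMstep p (x.length - (i + 1)) (REMiter p x i)

/-- The remainder modulo `p` of an unsigned number, as an unsigned number of
`p.size = ⌊log₂ p⌋ + 1` bits. -/
def REM (p : ℕ) (x : List (BoolCircuit V)) : List (BoolCircuit V) :=
  (List.range p.size).map fun j => ubit (REMiter p x x.length) j

def ADDp (p : ℕ) (x y : List (BoolCircuit V)) : List (BoolCircuit V) :=
  REM p (ADDplus x y)

def PRODp (p : ℕ) (x y : List (BoolCircuit V)) : List (BoolCircuit V) :=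
  REM p (PRODplus x y)

/-- The binary value modulo `p` of a vector of Boolean circuits. -/
noncomputable def VALp (p : ℕ) (x : List (BoolCircuit V)) : MvPolynomial V (ZMod p) :=
  ∑ i ∈ Finset.range x.length, MvPolynomial.C (2 ^ i : ZMod p) * (ubit x i).alg (ZMod p)

/-- The bits of an element of `𝔽_p`, seen as an element of `{0, …, p - 1}`. -/
def constBits (p : ℕ) (α : ZMod p) : List (BoolCircuit V) :=
  natBits p.size α.val

/-- The bits of `α * u` from the bits `x` of `u`: a wire with the label `1` passes its bits on, any
other label is multiplied by `PROD_p`. -/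
def scaleBits (p : ℕ) (α : ZMod p) (x : List (BoolCircuit V)) : List (BoolCircuit V) :=
  if α = 1 then x else PRODp p (constBits p α) x

/-- The bits of a linear combination, by repeated use of `ADD_p`; in particular the bits of `u + w`
are `ADD_p` of the bits of `u` and those of `w`. -/
def linBits (p : ℕ) : List (ZMod p × List (BoolCircuit V)) → List (BoolCircuit V)
  | [] => constBits p 0
  | [e] => scaleBits p e.1 e.2
  | e :: e' :: l => ADDp p (scaleBits p e.1 e.2) (linBits p (e' :: l))

end BoolCircuit

/-! ## Bit extraction modulo `p` -/

/-- The bits `x_{i,0}, …, x_{i,b-1}` of the variable `x_i`, where `b = p.size = ⌊log₂ p⌋ + 1`. -/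
def varBits (p : ℕ) {n : ℕ} (i : Fin n) : List (BoolCircuit (Fin n × Fin p.size)) :=
  (List.finRange p.size).map fun j => BoolCircuit.var (i, j)

/-- The bits of a gate, from the bits `B` and the polynomials `f` of its predecessors. An inversion
gate is treated as the constant that it computes. -/
noncomputable def AlgCirc.Gate.BITp {p n k : ℕ}
    (B : Fin k → List (BoolCircuit (Fin n × Fin p.size)))
    (f : Fin k → MvPolynomial (Fin n) (ZMod p)) :
    AlgCirc.Gate (ZMod p) (Fin n) k → List (BoolCircuit (Fin n × Fin p.size))
  | .var i => varBits p i
  | .const α => BoolCircuit.constBits p α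
  | .mul u w => BoolCircuit.PRODp p (B u) (B w)
  | .lin l => BoolCircuit.linBits p (l.map fun e => (e.1, B e.2))
  | .inv u => BoolCircuit.constBits p (MvPolynomial.constantCoeff (Ring.inverse (f u)))

noncomputable def AlgCirc.Gates.BITp {p n : ℕ} :
    {k : ℕ} → AlgCirc.Gates (ZMod p) (Fin n) k → Fin k →
      List (BoolCircuit (Fin n × Fin p.size))
  | _, .nil => Fin.elim0
  | _, .snoc c g => Fin.snoc (α := fun _ => List (BoolCircuit (Fin n × Fin p.size)))
      c.BITp (g.BITp c.BITp c.poly)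

/-- The vector of Boolean circuits that compute the bits of the output of `F`. -/
noncomputable def AlgCircuit.BITp {p n : ℕ} (F : AlgCircuit (ZMod p) (Fin n)) :
    List (BoolCircuit (Fin n × Fin p.size)) :=
  F.gates.BITp F.out

namespace BinaryValue

open MvPolynomial AlgCirc BoolCircuit

/-! ## Circuits as growing collections of certificates -/

/-- The substitution of the Boolean axioms for their placeholders. -/
noncomputable def substAxioms (p : ℕ) (V : Type) :
    MvPolynomial (V ⊕ V) (ZMod p) →ₐ[ZMod p] MvPolynomial V (ZMod p) :=
  aeval (Sum.elim X (boolAxiom (ZMod p) V))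

/-- The substitution of zero for the placeholders. -/
noncomputable def substZero (p : ℕ) (V : Type) :
    MvPolynomial (V ⊕ V) (ZMod p) →ₐ[ZMod p] MvPolynomial V (ZMod p) :=
  aeval (Sum.elim X fun _ => 0)

/-- A circuit over the variables and the placeholders of the Boolean axioms, some gates of which
certify `0` and compute a lift of `1`. -/
structure State (p : ℕ) (V : Type) where
  numGates : ℕ
  gates : Gates (ZMod p) (V ⊕ V) numGates
  admissible : gates.Admissible
  exists_zero : ∃ u, substAxioms p V (gates.poly u) = 0 ∧ substZero p V (gates.poly u) = 0
  exists_one : ∃ u, substAxioms p V (gates.poly u) = 1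

namespace State

variable {p : ℕ} {V : Type}

/-- Some gate computes a lift of `f`. -/
def Comp (s : State p V) (f : MvPolynomial V (ZMod p)) : Prop :=
  ∃ u, substAxioms p V (s.gates.poly u) = f

/-- Some gate computes an IPS certificate of `f` from the Boolean axioms. -/
def Zero (s : State p V) (f : MvPolynomial V (ZMod p)) : Prop :=
  ∃ u, substAxioms p V (s.gates.poly u) = f ∧ substZero p V (s.gates.poly u) = 0

/-- The polynomial `f` is computed and certified to be Boolean. -/
def Good (s : State p V) (f : MvPolynomial V (ZMod p)) : Prop :=
  s.Comp f ∧ s.Zero (f ^ 2 - f)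

/-- Everything computed or certified by `s` is so by `t`. -/
def Ext (s t : State p V) : Prop :=
  (∀ f, s.Comp f → t.Comp f) ∧ ∀ f, s.Zero f → t.Zero f

/-- An upper bound for the size of a gate with at most two incoming wires. -/
def gateBound (p : ℕ) : ℕ := 3 + 2 * p.size

/-- The state `t` extends `s` by what could be `n` gates with at most two incoming wires. -/
def Le (n : ℕ) (s t : State p V) : Prop :=
  s.Ext t ∧ t.gates.bitSize ≤ s.gates.bitSize + n * gateBound p

theorem Zero.comp {s : State p V} {f} (h : s.Zero f) : s.Comp f :=
  let ⟨u, hu⟩ := h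
  ⟨u, hu.1⟩

theorem zero_zero (s : State p V) : s.Zero 0 := s.exists_zero
theorem comp_one (s : State p V) : s.Comp 1 := s.exists_one

theorem good_zero (s : State p V) : s.Good 0 :=
  ⟨s.zero_zero.comp, by simpa using s.zero_zero⟩

theorem good_one (s : State p V) : s.Good 1 :=
  ⟨s.comp_one, by simpa using s.zero_zero⟩

theorem good_ite (s : State p V) (b : Bool) : s.Good (if b then 1 else 0) := by
  cases b
  · simpa using s.good_zero
  · simpa using s.good_one

theorem Ext.refl (s : State p V) : s.Ext s := ⟨fun _ h => h, fun _ h => h⟩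

theorem Ext.trans {s t r : State p V} (h : s.Ext t) (h' : t.Ext r) : s.Ext r :=
  ⟨fun f hf => h'.1 f (h.1 f hf), fun f hf => h'.2 f (h.2 f hf)⟩

theorem Ext.good {s t : State p V} (h : s.Ext t) {f} (hf : s.Good f) : t.Good f :=
  ⟨h.1 _ hf.1, h.2 _ hf.2⟩

theorem Le.comp {n : ℕ} {s t : State p V} (h : s.Le n t) {f} (hf : s.Comp f) : t.Comp f :=
  h.1.1 _ hf

theorem Le.zero {n : ℕ} {s t : State p V} (h : s.Le n t) {f} (hf : s.Zero f) : t.Zero f :=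
  h.1.2 _ hf

theorem Le.good {n : ℕ} {s t : State p V} (h : s.Le n t) {f} (hf : s.Good f) : t.Good f :=
  h.1.good hf

theorem Le.refl (s : State p V) : s.Le 0 s := ⟨Ext.refl s, by simp⟩

theorem Le.trans {n m : ℕ} {s t r : State p V} (h : s.Le n t) (h' : t.Le m r) :
    s.Le (n + m) r :=
  ⟨h.1.trans h'.1, by have := h.2; have := h'.2; rw [add_mul]; omega⟩

theorem Le.mono {n m : ℕ} {s t : State p V} (h : s.Le n t) (hnm : n ≤ m) : s.Le m t :=
  ⟨h.1, h.2.trans (by gcongr)⟩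

/-- Iteration of a construction of bounded cost. -/
theorem iterate {n : ℕ} (s : State p V) (m : ℕ) (Φ : ℕ → State p V → Prop) (h0 : Φ 0 s)
    (step : ∀ i < m, ∀ t, s.Ext t → Φ i t → ∃ t', t.Le n t' ∧ Φ (i + 1) t') :
    ∃ t, s.Le (n * m) t ∧ Φ m t := by
  induction m with
  | zero => exact ⟨s, by simpa using Le.refl s, h0⟩
  | succ m ih =>
    obtain ⟨t, ht, hΦ⟩ := ih fun i hi => step i (by omega)
    obtain ⟨t', ht', hΦ'⟩ := step m (by omega) t ht.1 hΦ
    exact ⟨t', by simpa [mul_add] using ht.trans ht', hΦ'⟩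

/-- The addition of a gate. -/
def snoc (s : State p V) (g : Gate (ZMod p) (V ⊕ V) s.numGates) (hg : g.Admissible s.gates) :
    State p V where
  numGates := s.numGates + 1
  gates := s.gates.snoc g
  admissible := ⟨s.admissible, hg⟩
  exists_zero := by
    obtain ⟨u, hu⟩ := s.exists_zero
    exact ⟨u.castSucc, by simpa [Gates.poly] using hu⟩
  exists_one := by
    obtain ⟨u, hu⟩ := s.exists_one
    exact ⟨u.castSucc, by simpa [Gates.poly] using hu⟩

theorem exists_snoc (s : State p V) (g : Gate (ZMod p) (V ⊕ V) s.numGates)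
    (hg : g.Admissible s.gates) (h : g.bitSize ≤ gateBound p) :
    ∃ t, s.Le 1 t ∧ ∃ u, t.gates.poly u = g.poly s.gates.poly := by
  refine ⟨s.snoc g hg, ⟨⟨fun f ⟨u, hu⟩ => ⟨u.castSucc, ?_⟩, fun f ⟨u, hu⟩ => ⟨u.castSucc, ?_⟩⟩,
    ?_⟩, Fin.last s.numGates, by simp [snoc, Gates.poly]⟩
  · simpa [snoc, Gates.poly] using hu
  · simpa [snoc, Gates.poly] using hu
  · simpa [snoc, Gates.bitSize] using h

theorem Comp.mul {s : State p V} {f g} (hf : s.Comp f) (hg : s.Comp g) :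
    ∃ t, s.Le 1 t ∧ t.Comp (f * g) := by
  obtain ⟨u, rfl⟩ := hf
  obtain ⟨w, rfl⟩ := hg
  obtain ⟨t, ht, v, hv⟩ := s.exists_snoc (.mul u w) trivial (by simp [Gate.bitSize, gateBound])
  refine ⟨t, ht, v, ?_⟩
  rw [hv]
  simp [Gate.poly]

theorem Zero.mul {s : State p V} {f g} (hf : s.Comp f) (hg : s.Zero g) :
    ∃ t, s.Le 1 t ∧ t.Zero (f * g) := by
  obtain ⟨u, rfl⟩ := hf
  obtain ⟨w, rfl, hw⟩ := hg
  obtain ⟨t, ht, v, hv⟩ := s.exists_snoc (.mul u w) trivial (by simp [Gate.bitSize, gateBound])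
  refine ⟨t, ht, v, ?_⟩
  rw [hv]
  simp [Gate.poly, hw]

theorem good_var (s : State p V) (v : V) : ∃ t, s.Le 2 t ∧ t.Good (X v) := by
  have h1 : (1 : ℕ) ≤ gateBound p := by simp only [gateBound]; omega
  obtain ⟨t, ht, x, hx⟩ := s.exists_snoc (.var (Sum.inl v)) trivial h1
  obtain ⟨t', ht', y, hy⟩ := t.exists_snoc (.var (Sum.inr v)) trivial h1
  refine ⟨t', ht.trans ht', ht'.comp ⟨x, ?_⟩, y, ?_⟩
  · simp [hx, Gate.poly, substAxioms]
  · simp [hy, Gate.poly, substAxioms, substZero, boolAxiom]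

section Rules

variable [Fact p.Prime]

theorem size_val_le (a : ZMod p) : a.val.size ≤ p.size :=
  Nat.size_le_size (ZMod.val_lt a).le

theorem bitSize_lin_le {k : ℕ} (a b : ZMod p) (u w : Fin k) :
    (Gate.lin [(a, u), (b, w)] : Gate (ZMod p) (V ⊕ V) k).bitSize ≤ gateBound p := by
  have := size_val_le a
  have := size_val_le b
  simp only [Gate.bitSize, gateBound, List.map_cons, List.map_nil, List.sum_cons, List.sum_nil]
  omega

theorem Comp.lin {s : State p V} {f g} (hf : s.Comp f) (hg : s.Comp g) (a b : ZMod p) :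
    ∃ t, s.Le 1 t ∧ t.Comp (C a * f + C b * g) := by
  obtain ⟨u, rfl⟩ := hf
  obtain ⟨w, rfl⟩ := hg
  obtain ⟨t, ht, v, hv⟩ := s.exists_snoc (.lin [(a, u), (b, w)]) trivial (bitSize_lin_le a b u w)
  refine ⟨t, ht, v, ?_⟩
  rw [hv]
  simp [Gate.poly, ← MvPolynomial.algebraMap_eq]

theorem Zero.lin {s : State p V} {f g} (hf : s.Zero f) (hg : s.Zero g) (a b : ZMod p) :
    ∃ t, s.Le 1 t ∧ t.Zero (C a * f + C b * g) := by
  obtain ⟨u, rfl, hu⟩ := hf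
  obtain ⟨w, rfl, hw⟩ := hg
  obtain ⟨t, ht, v, hv⟩ := s.exists_snoc (.lin [(a, u), (b, w)]) trivial (bitSize_lin_le a b u w)
  refine ⟨t, ht, v, ?_⟩
  rw [hv]
  simp [Gate.poly, ← MvPolynomial.algebraMap_eq, hu, hw]

theorem comp_const (s : State p V) (a : ZMod p) : ∃ t, s.Le 1 t ∧ t.Comp (C a) := by
  simpa using s.comp_one.lin s.comp_one a 0

/-- A linear combination of computed polynomials. -/
theorem comp_sum (s : State p V) (m : ℕ) (a : ℕ → ZMod p) (f : ℕ → MvPolynomial V (ZMod p))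
    (hf : ∀ i < m, s.Comp (f i)) :
    ∃ t, s.Le m t ∧ t.Comp (∑ i ∈ Finset.range m, C (a i) * f i) := by
  obtain ⟨t, ht, h⟩ := s.iterate (n := 1) m
    (fun i t => t.Comp (∑ i ∈ Finset.range i, C (a i) * f i)) (by simpa using s.zero_zero.comp)
    fun i hi t hst h => by simpa [Finset.sum_range_succ] using h.lin (hst.1 _ (hf i hi)) 1 (a i)
  exact ⟨t, by simpa using ht, h⟩

/-- A linear combination of certified polynomials. -/
theorem zero_sum (s : State p V) (m : ℕ) (a : ℕ → ZMod p) (f : ℕ → MvPolynomial V (ZMod p))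
    (hf : ∀ i < m, s.Zero (f i)) :
    ∃ t, s.Le m t ∧ t.Zero (∑ i ∈ Finset.range m, C (a i) * f i) := by
  obtain ⟨t, ht, h⟩ := s.iterate (n := 1) m
    (fun i t => t.Zero (∑ i ∈ Finset.range i, C (a i) * f i)) (by simpa using s.zero_zero)
    fun i hi t hst h => by simpa [Finset.sum_range_succ] using h.lin (hst.2 _ (hf i hi)) 1 (a i)
  exact ⟨t, by simpa using ht, h⟩

end Rules

end State

/-! ## Constant-size Boolean reasoning -/

/-- The value of a Boolean circuit in a commutative ring. -/
def ev {V B : Type} [CommRing B] (g : V → B) : BoolCircuit V → B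
  | .var v => g v
  | .const b => if b then 1 else 0
  | .not a => 1 - ev g a
  | .and a b => ev g a * ev g b
  | .or a b => 1 - (1 - ev g a) * (1 - ev g b)

/-- The truth value of a Boolean circuit. -/
def truth {V : Type} (a : V → Bool) : BoolCircuit V → Bool
  | .var v => a v
  | .const b => b
  | .not c => !truth a c
  | .and c d => truth a c && truth a d
  | .or c d => truth a c || truth a d

theorem map_ev {V A B : Type} [CommRing A] [CommRing B] (φ : A →+* B) (g : V → A)
    (c : BoolCircuit V) : φ (ev g c) = ev (fun v => φ (g v)) c := by
  induction c with
  | var v => rfl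
  | const b => cases b <;> simp [ev]
  | not a ih => simp [ev, ih]
  | and a b iha ihb => simp [ev, iha, ihb]
  | or a b iha ihb => simp [ev, iha, ihb]

section Idempotents

variable {k : ℕ} {B : Type} [CommRing B] (x : Fin k → B)

/-- The indicator of the Boolean point `a`. -/
def indicator (a : Fin k → Bool) : B := ∏ i, if a i then x i else 1 - x i

theorem sum_indicator : ∑ a, indicator x a = 1 := by
  have h := Finset.prod_univ_sum (fun _ : Fin k => (Finset.univ : Finset Bool))
    fun i b => if b then x i else 1 - x i
  simp only [Fintype.piFinset_univ] at h
  simp only [indicator, ← h]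
  simp

variable {x}

theorem mul_indicator (hx : ∀ i, x i ^ 2 - x i = 0) (a : Fin k → Bool) (i : Fin k) :
    x i * indicator x a = (if a i then 1 else 0) * indicator x a := by
  rw [indicator, ← Finset.mul_prod_erase _ _ (Finset.mem_univ i)]
  have := hx i
  cases a i
  · simp only [Bool.false_eq_true, if_false]
    linear_combination -(∏ j ∈ Finset.univ.erase i, if a j = true then x j else 1 - x j) * this
  · simp only [if_true]
    linear_combination (∏ j ∈ Finset.univ.erase i, if a j = true then x j else 1 - x j) * this

theorem ev_mul_indicator (hx : ∀ i, x i ^ 2 - x i = 0) (a : Fin k → Bool)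
    (c : BoolCircuit (Fin k)) :
    ev x c * indicator x a = (if truth a c then 1 else 0) * indicator x a := by
  induction c with
  | var v => exact mul_indicator hx a v
  | const b => rfl
  | not c ih =>
    simp only [ev, truth, sub_mul, ih]
    by_cases hc : truth a c = true <;> simp [hc]
  | and c d ihc ihd =>
    simp only [ev, truth]
    rw [mul_assoc, ihd, mul_left_comm, ihc]
    by_cases hc : truth a c = true <;> by_cases hd : truth a d = true <;> simp [hc, hd]
  | or c d ihc ihd =>
    simp only [ev, truth]
    have : (1 - (1 - ev x c) * (1 - ev x d)) * indicator x a =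
      ev x c * indicator x a + ev x d * indicator x a - ev x c * (ev x d * indicator x a) := by
      ring
    rw [this, ihd, mul_left_comm, ihc]
    by_cases hc : truth a c = true <;> by_cases hd : truth a d = true <;> simp [hc, hd]

theorem sum_ev_eq_zero (hx : ∀ i, x i ^ 2 - x i = 0) (H : List (BoolCircuit (Fin k)))
    (l : List (ℤ × BoolCircuit (Fin k)))
    (hl : ∀ a, (∀ c ∈ H, truth a c = true) →
      (l.map fun e => e.1 * if truth a e.2 then 1 else 0).sum = 0)
    (hH : ∀ c ∈ H, 1 - ev x c = 0) :
    (l.map fun e => (e.1 : B) * ev x e.2).sum = 0 := by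
  have key : ∀ a, (l.map fun e => (e.1 : B) * ev x e.2).sum * indicator x a =
      (((l.map fun e => e.1 * if truth a e.2 then 1 else 0).sum : ℤ) : B) * indicator x a := by
    intro a
    clear hl
    induction l with
    | nil => simp
    | cons e l ih =>
      simp only [List.map_cons, List.sum_cons, add_mul, ih, mul_assoc, ev_mul_indicator hx,
        Int.cast_add, Int.cast_mul]
      cases truth a e.2 <;> simp
  rw [← mul_one (List.sum _), ← sum_indicator x, Finset.mul_sum]
  refine Finset.sum_eq_zero fun a _ => ?_
  by_cases ha : ∀ c ∈ H, truth a c = true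
  · rw [key, hl a ha, Int.cast_zero, zero_mul]
  · push Not at ha
    obtain ⟨c, hc, hca⟩ := ha
    have h1 := ev_mul_indicator hx a c
    rw [← sub_eq_zero.1 (hH c hc), one_mul, if_neg hca, zero_mul] at h1
    rw [h1, mul_zero]

end Idempotents

section Templates

variable {k : ℕ}

theorem exists_comp_aeval (q : MvPolynomial (Fin k) ℤ) :
    ∃ N : ℕ, ∀ (p : ℕ) [Fact p.Prime] (V : Type) (s : State p V)
      (g : Fin k → MvPolynomial V (ZMod p)), (∀ i, s.Comp (g i)) →
      ∃ t, s.Le N t ∧ t.Comp (aeval g q) := by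
  induction q using MvPolynomial.induction_on with
  | C a =>
    refine ⟨1, fun p _ V s g hg => ?_⟩
    simpa using s.comp_const (a : ZMod p)
  | add q r hq hr =>
    obtain ⟨N, hN⟩ := hq
    obtain ⟨M, hM⟩ := hr
    refine ⟨N + M + 1, fun p _ V s g hg => ?_⟩
    obtain ⟨t, ht, hq⟩ := hN p V s g hg
    obtain ⟨t', ht', hr⟩ := hM p V t g fun i => ht.comp (hg i)
    obtain ⟨t'', ht'', h⟩ := (ht'.comp hq).lin hr 1 1
    exact ⟨t'', (ht.trans ht').trans ht'', by simpa using h⟩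
  | mul_X q i hq =>
    obtain ⟨N, hN⟩ := hq
    refine ⟨N + 1, fun p _ V s g hg => ?_⟩
    obtain ⟨t, ht, hq⟩ := hN p V s g hg
    obtain ⟨t', ht', h⟩ := hq.mul (ht.comp (hg i))
    exact ⟨t', ht.trans ht', by simpa using h⟩

theorem exists_zero_aeval (S : Set (MvPolynomial (Fin k) ℤ)) {f : MvPolynomial (Fin k) ℤ}
    (hf : f ∈ Ideal.span S) :
    ∃ N : ℕ, ∀ (p : ℕ) [Fact p.Prime] (V : Type) (s : State p V)
      (g : Fin k → MvPolynomial V (ZMod p)), (∀ i, s.Comp (g i)) →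
      (∀ r ∈ S, s.Zero (aeval g r)) → ∃ t, s.Le N t ∧ t.Zero (aeval g f) := by
  induction hf using Submodule.span_induction with
  | mem r hr => exact ⟨0, fun p _ V s g hg hS => ⟨s, .refl s, hS r hr⟩⟩
  | zero => exact ⟨0, fun p _ V s g hg hS => ⟨s, .refl s, by simpa using s.zero_zero⟩⟩
  | add q r _ _ hq hr =>
    obtain ⟨N, hN⟩ := hq
    obtain ⟨M, hM⟩ := hr
    refine ⟨N + M + 1, fun p _ V s g hg hS => ?_⟩
    obtain ⟨t, ht, hq⟩ := hN p V s g hg hS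
    obtain ⟨t', ht', hr⟩ := hM p V t g (fun i => ht.comp (hg i)) fun r hr => ht.zero (hS r hr)
    obtain ⟨t'', ht'', h⟩ := (ht'.zero hq).lin hr 1 1
    exact ⟨t'', (ht.trans ht').trans ht'', by simpa using h⟩
  | smul q r _ hr =>
    obtain ⟨N, hN⟩ := hr
    obtain ⟨M, hM⟩ := exists_comp_aeval q
    refine ⟨N + M + 1, fun p _ V s g hg hS => ?_⟩
    obtain ⟨t, ht, hr⟩ := hN p V s g hg hS
    obtain ⟨t', ht', hq⟩ := hM p V t g fun i => ht.comp (hg i)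
    obtain ⟨t'', ht'', h⟩ := State.Zero.mul hq (ht'.zero hr)
    exact ⟨t'', (ht.trans ht').trans ht'', by simpa using h⟩

/-- A linear combination of Boolean circuits that vanishes at the Boolean points satisfying `H` has
a certificate of constant size. -/
theorem exists_zero_ev (H : List (BoolCircuit (Fin k))) (l : List (ℤ × BoolCircuit (Fin k)))
    (hl : ∀ a, (∀ c ∈ H, truth a c = true) →
      (l.map fun e => e.1 * if truth a e.2 then 1 else 0).sum = 0) :
    ∃ N : ℕ, ∀ (p : ℕ) [Fact p.Prime] (V : Type) (s : State p V)
      (g : Fin k → MvPolynomial V (ZMod p)), (∀ i, s.Good (g i)) →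
      (∀ c ∈ H, s.Zero (1 - ev g c)) →
      ∃ t, s.Le N t ∧ t.Zero (l.map fun e => (e.1 : MvPolynomial V (ZMod p)) * ev g e.2).sum := by
  let S : Set (MvPolynomial (Fin k) ℤ) :=
    {f | (∃ i, f = X i ^ 2 - X i) ∨ ∃ c ∈ H, f = 1 - ev X c}
  have hmem : (l.map fun e => (e.1 : MvPolynomial (Fin k) ℤ) * ev X e.2).sum ∈ Ideal.span S := by
    rw [← Ideal.Quotient.eq_zero_iff_mem, map_list_sum, List.map_map]
    have h := sum_ev_eq_zero (x := fun i => Ideal.Quotient.mk (Ideal.span S) (X i)) ?_ H l hl ?_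
    · rw [← h]
      congr 1
      refine List.map_congr_left fun e _ => ?_
      simp [map_ev]
    · intro i
      rw [← map_pow, ← map_sub, Ideal.Quotient.eq_zero_iff_mem]
      exact Ideal.subset_span (Or.inl ⟨i, rfl⟩)
    · intro c hc
      rw [← map_ev, ← map_one (Ideal.Quotient.mk (Ideal.span S)), ← map_sub,
        Ideal.Quotient.eq_zero_iff_mem]
      exact Ideal.subset_span (Or.inr ⟨c, hc, rfl⟩)
  obtain ⟨N, hN⟩ := exists_zero_aeval S hmem
  refine ⟨N, fun p _ V s g hg hH => ?_⟩
  have hX : ∀ c : BoolCircuit (Fin k), aeval g (ev X c) = ev g c := fun c => by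
    simpa using map_ev (aeval g : MvPolynomial (Fin k) ℤ →ₐ[ℤ] _).toRingHom X c
  obtain ⟨t, ht, h⟩ := hN p V s g (fun i => (hg i).1) (by
    rintro r (⟨i, rfl⟩ | ⟨c, hc, rfl⟩)
    · simpa using (hg i).2
    · simpa [hX] using hH c hc)
  refine ⟨t, ht, ?_⟩
  rw [map_list_sum, List.map_map] at h
  rwa [show (fun e : ℤ × BoolCircuit (Fin k) => (e.1 : MvPolynomial V (ZMod p)) * ev g e.2) =
    aeval g ∘ fun e => (e.1 : MvPolynomial (Fin k) ℤ) * ev X e.2 by funext e; simp [hX]]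

/-- Boolean functions are Boolean. -/
theorem exists_good_ev (c : BoolCircuit (Fin k)) :
    ∃ N : ℕ, ∀ (p : ℕ) [Fact p.Prime] (V : Type) (s : State p V)
      (g : Fin k → MvPolynomial V (ZMod p)), (∀ i, s.Good (g i)) →
      ∃ t, s.Le N t ∧ t.Good (ev g c) := by
  obtain ⟨N, hN⟩ := exists_comp_aeval (ev X c)
  obtain ⟨M, hM⟩ := exists_zero_ev [] [(1, .and c c), (-1, c)] fun a _ => by
    cases h : truth a c <;> simp [truth, h]
  refine ⟨N + M, fun p _ V s g hg => ?_⟩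
  have hX : aeval g (ev X c : MvPolynomial (Fin k) ℤ) = ev g c := by
    simpa using map_ev (aeval g : MvPolynomial (Fin k) ℤ →ₐ[ℤ] _).toRingHom X c
  obtain ⟨t, ht, h⟩ := hN p V s g fun i => (hg i).1
  obtain ⟨t', ht', h'⟩ := hM p V t g (fun i => ht.good (hg i)) (by simp)
  refine ⟨t', ht.trans ht', ht'.comp (hX ▸ h), ?_⟩
  have : ev g c ^ 2 - ev g c = ev g c * ev g c + -ev g c := by ring
  simpa [ev, this] using h'

/-- A Boolean-valued conjunction over all Boolean points. -/
def allPoints : (k : ℕ) → ((Fin k → Bool) → Bool) → Bool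
  | 0, P => P ![]
  | k + 1, P => allPoints k (fun a => P (Matrix.vecCons false a)) &&
      allPoints k (fun a => P (Matrix.vecCons true a))

theorem forall_of_allPoints : ∀ {k : ℕ} {P : (Fin k → Bool) → Bool}, allPoints k P = true →
    ∀ a, P a = true
  | 0, P, h, a => by rwa [Subsingleton.elim a ![]]
  | k + 1, P, h, a => by
    simp only [allPoints, Bool.and_eq_true] at h
    have ha : Matrix.vecCons (a 0) (fun i => a i.succ) = a := Matrix.cons_head_tail a
    rw [← ha]
    cases a 0
    · exact forall_of_allPoints h.1 _
    · exact forall_of_allPoints h.2 _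

/-- The circuits in `H` imply those in `T`, and the linear combinations in `Z` vanish where `H`
holds. -/
def entails (H T : List (BoolCircuit (Fin k))) (Z : List (List (ℤ × BoolCircuit (Fin k)))) :
    Bool :=
  allPoints k fun a => !(H.all (truth a)) || (T.all (truth a) &&
    Z.all fun l => decide ((l.map fun e => e.1 * if truth a e.2 then 1 else 0).sum = 0))

/-- Constant-size Boolean reasoning: if the polynomials `g i` are Boolean and satisfy `H`, then
constantly many steps show that the circuits `G` are Boolean, that the circuits `T` hold, and that
the linear combinations `Z` vanish. -/
theorem exists_entails (H G T : List (BoolCircuit (Fin k)))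
    (Z : List (List (ℤ × BoolCircuit (Fin k)))) (h : entails H T Z = true) :
    ∃ N : ℕ, ∀ (p : ℕ) [Fact p.Prime] (V : Type) (s : State p V)
      (g : Fin k → MvPolynomial V (ZMod p)), (∀ i, s.Good (g i)) →
      (∀ c ∈ H, s.Zero (1 - ev g c)) →
      ∃ t, s.Le N t ∧ (∀ c ∈ G, t.Good (ev g c)) ∧ (∀ c ∈ T, t.Zero (1 - ev g c)) ∧
        ∀ l ∈ Z, t.Zero (l.map fun e => (e.1 : MvPolynomial V (ZMod p)) * ev g e.2).sum := by
  have hent : ∀ a, (∀ c ∈ H, truth a c = true) → (∀ c ∈ T, truth a c = true) ∧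
      ∀ l ∈ Z, (l.map fun e => e.1 * if truth a e.2 then 1 else 0).sum = 0 := by
    intro a ha
    have := forall_of_allPoints h a
    have hH : H.all (truth a) = true := List.all_eq_true.2 ha
    simpa [hH] using this
  clear h
  induction G with
  | cons c G ih =>
    obtain ⟨N, hN⟩ := ih
    obtain ⟨M, hM⟩ := exists_good_ev c
    refine ⟨N + M, fun p _ V s g hg hH => ?_⟩
    obtain ⟨t, ht, hG, hT, hZ⟩ := hN p V s g hg hH
    obtain ⟨t', ht', hc⟩ := hM p V t g fun i => ht.good (hg i)
    refine ⟨t', ht.trans ht', ?_, fun c hc => ht'.zero (hT c hc), fun l hl => ht'.zero (hZ l hl)⟩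
    intro d hd
    rcases List.mem_cons.1 hd with rfl | hd
    · exact hc
    · exact ht'.good (hG d hd)
  | nil =>
    induction T with
    | cons c T ih =>
      obtain ⟨N, hN⟩ := ih fun a ha => ⟨fun c hc => (hent a ha).1 c (by simp [hc]), (hent a ha).2⟩
      obtain ⟨M, hM⟩ := exists_zero_ev H [(1, .const true), (-1, c)] fun a ha => by
        simp [truth, (hent a ha).1 c (by simp)]
      refine ⟨N + M, fun p _ V s g hg hH => ?_⟩
      obtain ⟨t, ht, hG, hT, hZ⟩ := hN p V s g hg hH
      obtain ⟨t', ht', hc⟩ := hM p V t g (fun i => ht.good (hg i)) fun c hc => ht.zero (hH c hc)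
      refine ⟨t', ht.trans ht', by simp, ?_, fun l hl => ht'.zero (hZ l hl)⟩
      intro d hd
      rcases List.mem_cons.1 hd with rfl | hd
      · simpa [ev, sub_eq_add_neg] using hc
      · exact ht'.zero (hT d hd)
    | nil =>
      induction Z with
      | cons l Z ih =>
        obtain ⟨N, hN⟩ := ih fun a ha => ⟨by simp, fun c hc => (hent a ha).2 c (by simp [hc])⟩
        obtain ⟨M, hM⟩ := exists_zero_ev H l fun a ha => (hent a ha).2 l (by simp)
        refine ⟨N + M, fun p _ V s g hg hH => ?_⟩
        obtain ⟨t, ht, hG, hT, hZ⟩ := hN p V s g hg hH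
        obtain ⟨t', ht', hc⟩ := hM p V t g (fun i => ht.good (hg i)) fun c hc => ht.zero (hH c hc)
        refine ⟨t', ht.trans ht', by simp, by simp, ?_⟩
        intro d hd
        rcases List.mem_cons.1 hd with rfl | hd
        · exact hc
        · exact ht'.zero (hZ d hd)
      | nil => exact ⟨0, fun p _ V s g hg hH => ⟨s, .refl s, by simp, by simp, by simp⟩⟩

/-- The substitution of circuits for the variables of a circuit. -/
def subst {W V : Type} (w : W → BoolCircuit V) : BoolCircuit W → BoolCircuit V
  | .var v => w v
  | .const b => .const b
  | .not a => .not (subst w a)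
  | .and a b => .and (subst w a) (subst w b)
  | .or a b => .or (subst w a) (subst w b)

theorem alg_subst {W V : Type} (R : Type) [CommRing R] (w : W → BoolCircuit V)
    (c : BoolCircuit W) : (subst w c).alg R = ev (fun v => (w v).alg R) c := by
  induction c with
  | var v => rfl
  | const b => rfl
  | not a ih => simp only [subst, BoolCircuit.alg, ev, ih]
  | and a b iha ihb => simp only [subst, BoolCircuit.alg, ev, iha, ihb]
  | or a b iha ihb => simp only [subst, BoolCircuit.alg, ev, iha, ihb]

/-- The Boolean circuit `c` is certified to be true. -/
def Holds {p : ℕ} {V : Type} (s : State p V) (c : BoolCircuit V) : Prop :=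
  s.Zero (1 - c.alg (ZMod p))

/-- Constant-size Boolean reasoning about circuits. -/
theorem exists_entails_circuit (H G T : List (BoolCircuit (Fin k)))
    (Z : List (List (ℤ × BoolCircuit (Fin k)))) (h : entails H T Z = true) :
    ∃ N : ℕ, ∀ (p : ℕ) [Fact p.Prime] (V : Type) (s : State p V)
      (w : Fin k → BoolCircuit V), (∀ i, s.Good ((w i).alg (ZMod p))) →
      (∀ c ∈ H, Holds s (subst w c)) →
      ∃ t, s.Le N t ∧ (∀ c ∈ G, t.Good ((subst w c).alg (ZMod p))) ∧
        (∀ c ∈ T, Holds t (subst w c)) ∧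
        ∀ l ∈ Z, t.Zero (l.map fun e =>
          (e.1 : MvPolynomial V (ZMod p)) * (subst w e.2).alg (ZMod p)).sum := by
  obtain ⟨N, hN⟩ := exists_entails H G T Z h
  refine ⟨N, fun p _ V s w hw hH => ?_⟩
  simp only [Holds, alg_subst] at hH ⊢
  exact hN p V s _ hw hH

end Templates

/-! ## Addition and multiplication -/

theorem State.iterate_forall {p : ℕ} {V : Type} {n : ℕ} (s : State p V) (m : ℕ)
    (Φ : ℕ → State p V → Prop) (mono : ∀ i t t', t.Ext t' → Φ i t → Φ i t')
    (step : ∀ i < m, ∀ t, s.Ext t → ∃ t', t.Le n t' ∧ Φ i t') :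
    ∃ t, s.Le (n * m) t ∧ ∀ i < m, Φ i t := by
  refine s.iterate m (fun i t => ∀ j < i, Φ j t) (by simp) fun i hi t ht h => ?_
  obtain ⟨t', ht', h'⟩ := step i hi t ht
  refine ⟨t', ht', fun j hj => ?_⟩
  rcases Nat.lt_succ_iff_lt_or_eq.1 hj with hj | rfl
  · exact mono j t t' ht'.1 (h j hj)
  · exact h'

section Lists

variable {V : Type}

theorem map_eq_map_range (x : List (BoolCircuit V)) (f : BoolCircuit V → BoolCircuit V) :
    x.map f = (List.range x.length).map fun i => f (ubit x i) := by
  refine List.ext_getElem (by simp) fun i h _ => ?_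
  simp only [List.length_map] at h
  simp [ubit, h]

theorem ubit_map_range (f : ℕ → BoolCircuit V) {m i : ℕ} (h : i < m) :
    ubit ((List.range m).map f) i = f i := by
  simp [ubit, h]

theorem ubit_of_le {x : List (BoolCircuit V)} {i : ℕ} (h : x.length ≤ i) :
    ubit x i = const false := by
  simp [ubit, h]

theorem sign_append_false (x : List (BoolCircuit V)) : sign (x ++ [const false]) = const false := by
  simp [sign]

theorem sbit_append_false (x : List (BoolCircuit V)) (i : ℕ) :
    sbit (x ++ [const false]) i = ubit x i := by
  rw [sbit, sign_append_false, ubit]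
  rcases lt_or_ge i x.length with h | h
  · rw [List.getD_append _ _ _ _ h]
  · rw [List.getD_append_right _ _ _ _ h, List.getD_eq_default _ _ h]
    rcases h.eq_or_lt with h | h
    · simp [h]
    · rw [List.getD_eq_default]
      simp; omega

/-- The bit `i` of the sum of two numbers in two's complement. -/
def sumBit (x y : List (BoolCircuit V)) (i : ℕ) : BoolCircuit V :=
  xor (xor (sbit x i) (sbit y i)) (CARRY x y i)

theorem ADD_eq (x y : List (BoolCircuit V)) :
    ADD x y = (List.range (max x.length y.length + 1)).map (sumBit x y) := rfl

theorem ADDplus_eq (x y : List (BoolCircuit V)) :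
    ADDplus x y = (List.range (max x.length y.length + 1)).map
      (sumBit (x ++ [const false]) (y ++ [const false])) := by
  rw [ADDplus, ADD_eq, List.range_succ, List.map_append, List.map_singleton, List.dropLast_concat]
  simp

theorem length_ADDplus (x y : List (BoolCircuit V)) :
    (ADDplus x y).length = max x.length y.length + 1 := by
  simp [ADDplus_eq]

theorem length_PRODplusAux (x y : List (BoolCircuit V)) (i : ℕ) :
    (PRODplusAux x y i).length = x.length + i := by
  induction i with
  | zero => simp [PRODplusAux]
  | succ i ih =>
    simp [PRODplusAux, length_ADDplus, ih]
    omega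

theorem length_PRODplus (x y : List (BoolCircuit V)) :
    (PRODplus x y).length = x.length + y.length :=
  length_PRODplusAux x y _

end Lists

section Values

variable {V : Type} (p : ℕ)

theorem VALp_eq_sum (x : List (BoolCircuit V)) {m : ℕ} (h : x.length ≤ m) :
    VALp p x = ∑ i ∈ Finset.range m, C (2 ^ i : ZMod p) * (ubit x i).alg (ZMod p) := by
  refine Finset.sum_subset (by simpa using h) fun i _ hi => ?_
  rw [ubit_of_le (by simpa using hi)]
  simp [alg]

theorem VALp_map_range (f : ℕ → BoolCircuit V) (m : ℕ) :
    VALp p ((List.range m).map f) =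
      ∑ i ∈ Finset.range m, C (2 ^ i : ZMod p) * (f i).alg (ZMod p) := by
  rw [VALp]
  simp only [List.length_map, List.length_range]
  exact Finset.sum_congr rfl fun i hi => by rw [ubit_map_range f (Finset.mem_range.1 hi)]

theorem VALp_nil : VALp p ([] : List (BoolCircuit V)) = 0 := by simp [VALp]

theorem VALp_cons (a : BoolCircuit V) (x : List (BoolCircuit V)) :
    VALp p (a :: x) = a.alg (ZMod p) + C 2 * VALp p x := by
  rw [VALp, VALp, List.length_cons, Finset.sum_range_succ', Finset.mul_sum, add_comm]
  congr 1
  · simp [ubit]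
  · refine Finset.sum_congr rfl fun i _ => ?_
    simp only [ubit, List.getD_cons_succ, pow_succ, C_mul]
    ring

theorem VALp_append (x y : List (BoolCircuit V)) :
    VALp p (x ++ y) = VALp p x + C (2 ^ x.length) * VALp p y := by
  induction x with
  | nil => simp [VALp_nil]
  | cons a x ih =>
    simp only [List.cons_append, VALp_cons, ih, List.length_cons, pow_succ, C_mul]
    ring

theorem VALp_map_and (x : List (BoolCircuit V)) (c : BoolCircuit V) :
    VALp p (x.map fun a => and a c) = VALp p x * c.alg (ZMod p) := by
  induction x with
  | nil => simp [VALp_nil]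
  | cons a x ih =>
    simp only [List.map_cons, VALp_cons, ih, alg]
    ring

theorem VALp_replicate_false (m : ℕ) :
    VALp p (List.replicate m (const false) : List (BoolCircuit V)) = 0 := by
  induction m with
  | zero => exact VALp_nil p
  | succ m ih => simp [List.replicate_succ, VALp_cons, ih, alg]

end Values

section Goodness

variable {p : ℕ} {V : Type}

/-- The bits of `x` are computed and certified to be Boolean. -/
def GoodBits (s : State p V) (x : List (BoolCircuit V)) : Prop :=
  ∀ a ∈ x, s.Good (a.alg (ZMod p))

theorem GoodBits.ext {s t : State p V} (h : s.Ext t) {x} (hx : GoodBits s x) : GoodBits t x :=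
  fun a ha => h.good (hx a ha)

theorem good_const (s : State p V) (b : Bool) :
    s.Good ((const b : BoolCircuit V).alg (ZMod p)) :=
  s.good_ite b

theorem GoodBits.ubit {s : State p V} {x} (hx : GoodBits s x) (i : ℕ) :
    s.Good ((ubit x i).alg (ZMod p)) := by
  rcases lt_or_ge i x.length with h | h
  · rw [BoolCircuit.ubit, List.getD_eq_getElem _ _ h]
    exact hx _ (List.getElem_mem h)
  · rw [ubit_of_le h]
    exact good_const s false

theorem goodBits_map_range {s : State p V} {f : ℕ → BoolCircuit V} {m : ℕ} :
    GoodBits s ((List.range m).map f) ↔ ∀ i < m, s.Good ((f i).alg (ZMod p)) := by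
  simp [GoodBits]

theorem GoodBits.append {s : State p V} {x y} (hx : GoodBits s x) (hy : GoodBits s y) :
    GoodBits s (x ++ y) := fun a ha => by
  rcases List.mem_append.1 ha with h | h
  · exact hx a h
  · exact hy a h

theorem GoodBits.comp_VALp [Fact p.Prime] {s : State p V} {x} (hx : GoodBits s x) :
    ∃ t, s.Le x.length t ∧ t.Comp (VALp p x) :=
  s.comp_sum _ _ _ fun i _ => (hx.ubit i).1

end Goodness

/-- The carry of a full adder. -/
def fullCarry {V : Type} (a b c : BoolCircuit V) : BoolCircuit V :=
  or (and a b) (and (or a b) c)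

/-- Ripple-carry addition is correct. -/
theorem exists_adder : ∃ N : ℕ, ∀ (p : ℕ) [Fact p.Prime] (V : Type) (s : State p V)
    (x y : List (BoolCircuit V)) (m : ℕ), (∀ i < m, s.Good ((sbit x i).alg (ZMod p))) →
    (∀ i < m, s.Good ((sbit y i).alg (ZMod p))) →
    ∃ t, s.Le (N * m) t ∧ (∀ i ≤ m, t.Good ((CARRY x y i).alg (ZMod p))) ∧
      (∀ i < m, t.Good ((sumBit x y i).alg (ZMod p))) ∧
      t.Zero (∑ i ∈ Finset.range m, C (2 ^ i : ZMod p) * (sumBit x y i).alg (ZMod p) +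
        C (2 ^ m) * (CARRY x y m).alg (ZMod p) -
        ∑ i ∈ Finset.range m,
          C (2 ^ i : ZMod p) * ((sbit x i).alg (ZMod p) + (sbit y i).alg (ZMod p))) := by
  let sm : BoolCircuit (Fin 3) := xor (xor (var 0) (var 1)) (var 2)
  let cy : BoolCircuit (Fin 3) := fullCarry (var 0) (var 1) (var 2)
  obtain ⟨N, hN⟩ := exists_entails [] [sm, cy] []
    [[(1, sm), (2, cy), (-1, var 0), (-1, var 1), (-1, var 2)]] (by decide +kernel)
  refine ⟨N + 1, fun p _ V s x y m hx hy => ?_⟩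
  refine s.iterate (n := N + 1) m (fun m t =>
      (∀ i ≤ m, t.Good ((CARRY x y i).alg (ZMod p))) ∧
      (∀ i < m, t.Good ((sumBit x y i).alg (ZMod p))) ∧
      t.Zero (∑ i ∈ Finset.range m, C (2 ^ i : ZMod p) * (sumBit x y i).alg (ZMod p) +
        C (2 ^ m) * (CARRY x y m).alg (ZMod p) -
        ∑ i ∈ Finset.range m,
          C (2 ^ i : ZMod p) * ((sbit x i).alg (ZMod p) + (sbit y i).alg (ZMod p))))
    ⟨by simpa [CARRY] using good_const s false, by simp, by simpa [CARRY, alg] using s.zero_zero⟩ ?_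
  intro i hi t hst ⟨hc, hs, hz⟩
  obtain ⟨t1, ht1, hG, -, hZ⟩ := hN p V t
    ![(sbit x i).alg (ZMod p), (sbit y i).alg (ZMod p), (CARRY x y i).alg (ZMod p)]
    (by
      intro j
      fin_cases j
      · exact hst.good (hx i hi)
      · exact hst.good (hy i hi)
      · exact hc i le_rfl) (by simp)
  have hG1 : t1.Good ((sumBit x y i).alg (ZMod p)) := hG sm (by simp)
  have hG2 : t1.Good ((CARRY x y (i + 1)).alg (ZMod p)) := hG cy (by simp)
  have hZ1 : t1.Zero (((1 : ℤ) : MvPolynomial V (ZMod p)) * (sumBit x y i).alg (ZMod p) +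
      (((2 : ℤ) : MvPolynomial V (ZMod p)) * (CARRY x y (i + 1)).alg (ZMod p) +
      (((-1 : ℤ) : MvPolynomial V (ZMod p)) * (sbit x i).alg (ZMod p) +
      (((-1 : ℤ) : MvPolynomial V (ZMod p)) * (sbit y i).alg (ZMod p) +
      (((-1 : ℤ) : MvPolynomial V (ZMod p)) * (CARRY x y i).alg (ZMod p) + 0))))) :=
    hZ _ (List.mem_singleton_self _)
  obtain ⟨t2, ht2, h2⟩ := (ht1.zero hz).lin hZ1 1 (2 ^ i)
  refine ⟨t2, ht1.trans ht2, fun j hj => ?_, fun j hj => ?_, ?_⟩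
  · rcases Nat.le_succ_iff.1 hj with hj | rfl
    · exact ht2.good (ht1.good (hc j hj))
    · exact ht2.good hG2
  · rcases Nat.lt_succ_iff_lt_or_eq.1 hj with hj | rfl
    · exact ht2.good (ht1.good (hs j hj))
    · exact ht2.good hG1
  · convert h2 using 1
    simp only [Finset.sum_range_succ, pow_succ, C_mul, C_1, Int.cast_one, Int.cast_neg,
      Int.cast_ofNat, show (C (2 : ZMod p) : MvPolynomial V (ZMod p)) = 2 from map_ofNat C 2]
    ring

/-- Unsigned addition is correct. -/
theorem exists_ADDplus : ∃ N : ℕ, ∀ (p : ℕ) [Fact p.Prime] (V : Type) (s : State p V)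
    (x y : List (BoolCircuit V)), GoodBits s x → GoodBits s y →
    ∃ t, s.Le (N * (max x.length y.length + 1)) t ∧ GoodBits t (ADDplus x y) ∧
      t.Zero (VALp p (ADDplus x y) - VALp p x - VALp p y) := by
  obtain ⟨N, hN⟩ := exists_adder
  refine ⟨N, fun p _ V s x y hx hy => ?_⟩
  obtain ⟨t, ht, -, hs, hz⟩ := hN p V s (x ++ [const false]) (y ++ [const false])
    (max x.length y.length + 1) (fun i _ => by simpa [sbit_append_false] using hx.ubit i)
    (fun i _ => by simpa [sbit_append_false] using hy.ubit i)
  refine ⟨t, ht, ?_, ?_⟩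
  · rw [ADDplus_eq, goodBits_map_range]
    exact hs
  · convert hz using 1
    have hcarry : (CARRY (x ++ [const false]) (y ++ [const false])
        (max x.length y.length + 1)).alg (ZMod p) = 0 := by
      rw [CARRY, sbit_append_false, sbit_append_false, ubit_of_le (le_max_left _ _),
        ubit_of_le (le_max_right _ _)]
      simp [alg]
    rw [ADDplus_eq, VALp_map_range, hcarry,
      VALp_eq_sum p x (m := max x.length y.length + 1) (by omega),
      VALp_eq_sum p y (m := max x.length y.length + 1) (by omega)]
    simp only [sbit_append_false, mul_add, Finset.sum_add_distrib]
    ring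

/-- Conjunctions of Boolean polynomials are Boolean. -/
theorem exists_good_and : ∃ N : ℕ, ∀ (p : ℕ) [Fact p.Prime] (V : Type) (s : State p V)
    (a b : BoolCircuit V), s.Good (a.alg (ZMod p)) → s.Good (b.alg (ZMod p)) →
    ∃ t, s.Le N t ∧ t.Good ((and a b).alg (ZMod p)) := by
  obtain ⟨N, hN⟩ := exists_good_ev (and (var 0) (var 1) : BoolCircuit (Fin 2))
  refine ⟨N, fun p _ V s a b ha hb => ?_⟩
  obtain ⟨t, ht, h⟩ := hN p V s ![a.alg (ZMod p), b.alg (ZMod p)] (by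
    intro i
    fin_cases i
    · exact ha
    · exact hb)
  exact ⟨t, ht, h⟩

/-- Unsigned multiplication is correct. -/
theorem exists_PRODplus : ∃ N : ℕ, ∀ (p : ℕ) [Fact p.Prime] (V : Type) (s : State p V)
    (x y : List (BoolCircuit V)), GoodBits s x → GoodBits s y →
    ∃ t, s.Le (N * (x.length + 1) * (y.length + 1)) t ∧ GoodBits t (PRODplus x y) ∧
      t.Zero (VALp p (PRODplus x y) - VALp p x * VALp p y) := by
  obtain ⟨N, hN⟩ := exists_ADDplus
  obtain ⟨M, hM⟩ := exists_good_and
  refine ⟨N + M + 2, fun p _ V s x y hx hy => ?_⟩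
  obtain ⟨s', hs', hX⟩ := hx.comp_VALp
  suffices h : ∃ t, s'.Le ((M * x.length + N * (x.length + 1) + 1 + 1) * y.length) t ∧
      GoodBits t (PRODplus x y) ∧ t.Zero (VALp p (PRODplus x y) - VALp p x * VALp p y) by
    obtain ⟨t, ht, h⟩ := h
    refine ⟨t, (hs'.trans ht).mono ?_, h⟩
    nlinarith [Nat.zero_le (M * y.length), Nat.zero_le (x.length * y.length),
      Nat.zero_le (M * x.length), Nat.zero_le (N * x.length)]
  refine s'.iterate y.length
    (fun i t => GoodBits t (PRODplusAux x y i) ∧ t.Zero (VALp p (PRODplusAux x y i) -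
      VALp p x * ∑ j ∈ Finset.range i, C (2 ^ j : ZMod p) * (ubit y j).alg (ZMod p)))
    ⟨?_, ?_⟩ ?_
  · intro a ha
    rw [List.eq_of_mem_replicate ha]
    exact good_const _ false
  · simpa [PRODplusAux, VALp_replicate_false] using s'.zero_zero
  · intro i _ t hst ⟨hG, hZ⟩
    have hext := hs'.1.trans hst
    have hlen := length_PRODplusAux x y i
    obtain ⟨t1, ht1, h1⟩ := t.iterate_forall (n := M) x.length
      (fun j t => t.Good ((and (ubit x j) (ubit y i)).alg (ZMod p))) (fun j t t' h => h.good)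
      fun j _ t' h => hM p V t' _ _ (h.good (hext.good (hx.ubit j)))
        (h.good (hext.good (hy.ubit i)))
    have h1' : GoodBits t1 (x.map fun a => and a (ubit y i)) := by
      rw [map_eq_map_range, goodBits_map_range]
      exact h1
    obtain ⟨t2, ht2, hG2, hZ2⟩ := hN p V t1 ((PRODplusAux x y i).drop i)
      (x.map fun a => and a (ubit y i))
      (fun a ha => ht1.good (hG a (List.mem_of_mem_drop ha))) h1'
    obtain ⟨t3, ht3, h3⟩ := (ht2.zero (ht1.zero hZ)).lin hZ2 1 (2 ^ i)
    refine ⟨t3, ((ht1.trans (ht2.trans ht3)).mono ?_), ?_, ?_⟩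
    · simp only [List.length_drop, List.length_map, hlen, Nat.add_sub_cancel, max_self]
      omega
    · exact GoodBits.append (fun a ha => ht3.good (ht2.good (ht1.good
        (hG a (List.mem_of_mem_take ha))))) (hG2.ext ht3.1)
    · convert h3 using 1
      have hsplit : VALp p (PRODplusAux x y i) = VALp p ((PRODplusAux x y i).take i) +
          C (2 ^ i) * VALp p ((PRODplusAux x y i).drop i) := by
        conv_lhs => rw [← List.take_append_drop i (PRODplusAux x y i), VALp_append]
        simp [hlen]
      rw [hsplit, PRODplusAux, VALp_append, VALp_map_and, Finset.sum_range_succ]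
      simp only [List.length_take, hlen, Nat.min_eq_left (Nat.le_add_left i x.length), C_1]
      ring

/-! ## Circuits with constant values -/

theorem getLsbD_ofInt {w i : ℕ} (h : i < w) (a : ℤ) :
    (BitVec.ofInt w a).getLsbD i = a.testBit i := by
  cases a with
  | ofNat n => simp [Int.testBit, BitVec.getLsbD_ofNat, h, -BitVec.getLsbD_eq_getElem]
  | negSucc n => simp [Int.testBit, BitVec.ofInt_negSucc_eq_not_ofNat, h, BitVec.getLsbD_ofNat,
      -BitVec.getLsbD_eq_getElem]

/-- The carry into position `i` in the addition of two integers. -/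
def intCarry (a b : ℤ) : ℕ → Bool
  | 0 => false
  | i + 1 => (a.testBit i).atLeastTwo (b.testBit i) (intCarry a b i)

theorem testBit_add (a b : ℤ) (i : ℕ) :
    (a + b).testBit i = ((a.testBit i ^^ b.testBit i) ^^ intCarry a b i) := by
  have hcarry : ∀ j ≤ i, BitVec.carry j (BitVec.ofInt (i + 1) a) (BitVec.ofInt (i + 1) b) false =
      intCarry a b j := by
    intro j hj
    induction j with
    | zero => simp [intCarry]
    | succ j ih =>
      rw [BitVec.carry_succ, ih (by omega), getLsbD_ofInt (by omega), getLsbD_ofInt (by omega),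
        intCarry]
  have hi : i < i + 1 := by omega
  rw [← getLsbD_ofInt hi, BitVec.ofInt_add, BitVec.getLsbD_add hi, getLsbD_ofInt hi,
    getLsbD_ofInt hi, hcarry i le_rfl, Bool.xor_assoc]

theorem testBit_natCast (n i : ℕ) : (n : ℤ).testBit i = n.testBit i := rfl

theorem sum_testBit (n b : ℕ) :
    ∑ j ∈ Finset.range b, 2 ^ j * (if n.testBit j then 1 else 0) = n % 2 ^ b := by
  induction b with
  | zero => simp [Nat.mod_one]
  | succ b ih =>
    rw [Finset.sum_range_succ, ih, Nat.mod_pow_succ, Nat.testBit_eq_decide_div_mod_eq]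
    rcases Nat.mod_two_eq_zero_or_one (n / 2 ^ b) with h | h <;> simp [h]

section

variable {V : Type} (p : ℕ)

/-- The Boolean circuit `c` is translated to the constant `b`. -/
def HasValue (c : BoolCircuit V) (b : Bool) : Prop :=
  c.alg (ZMod p) = if b then 1 else 0

variable {p}

theorem hasValue_const (b : Bool) : HasValue p (const b : BoolCircuit V) b := rfl

theorem HasValue.not {c : BoolCircuit V} {b : Bool} (h : HasValue p c b) :
    HasValue p (.not c) (!b) := by
  cases b <;> simp_all [HasValue, alg]

theorem HasValue.and {c d : BoolCircuit V} {a b : Bool} (hc : HasValue p c a)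
    (hd : HasValue p d b) : HasValue p (.and c d) (a && b) := by
  cases a <;> cases b <;> simp_all [HasValue, alg]

theorem HasValue.or {c d : BoolCircuit V} {a b : Bool} (hc : HasValue p c a)
    (hd : HasValue p d b) : HasValue p (.or c d) (a || b) := by
  cases a <;> cases b <;> simp_all [HasValue, alg]

theorem HasValue.xor {c d : BoolCircuit V} {a b : Bool} (hc : HasValue p c a)
    (hd : HasValue p d b) : HasValue p (.xor c d) (a ^^ b) := by
  have h := (hc.and hd.not).or (hc.not.and hd)
  cases a <;> cases b <;> exact h

theorem HasValue.unique [Fact p.Prime] {c : BoolCircuit V} {a b : Bool} (ha : HasValue p c a)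
    (hb : HasValue p c b) : a = b := by
  cases a <;> cases b <;> simp_all [HasValue]

variable (p)

/-- The number in two's complement with the bits `x` is the constant `a`. -/
def IntValue (x : List (BoolCircuit V)) (a : ℤ) : Prop :=
  ∀ j, HasValue p (sbit x j) (a.testBit j)

/-- The unsigned number with the bits `x` is the constant `n`. -/
def NatValue (x : List (BoolCircuit V)) (n : ℕ) : Prop :=
  ∀ j, HasValue p (ubit x j) (n.testBit j)

variable {p}

theorem sbit_eq_sign {x : List (BoolCircuit V)} {j : ℕ} (h : x.length ≤ j + 1) :
    sbit x j = sign x := by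
  rcases Nat.lt_or_ge j x.length with hj | hj
  · rw [sbit, List.getD_eq_getElem _ _ hj, sign, List.getLastD_eq_getLast?,
      List.getLast?_eq_getElem?, show x.length - 1 = j by omega, List.getElem?_eq_getElem hj]
    rfl
  · rw [sbit, List.getD_eq_default _ _ hj]

theorem sbit_map_range (f : ℕ → BoolCircuit V) (m j : ℕ) :
    sbit ((List.range (m + 1)).map f) j = f (min j m) := by
  rcases Nat.lt_or_ge j (m + 1) with hj | hj
  · rw [sbit, List.getD_eq_getElem _ _ (by simpa using hj), min_eq_left (by omega)]
    simp
  · rw [sbit_eq_sign (by simp; omega), sign, List.range_succ, List.map_append, List.map_singleton,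
      List.getLastD_concat, min_eq_right (by omega)]

theorem IntValue.hasValue_CARRY {x y : List (BoolCircuit V)} {a b : ℤ} (hx : IntValue p x a)
    (hy : IntValue p y b) (j : ℕ) : HasValue p (CARRY x y j) (intCarry a b j) := by
  induction j with
  | zero => exact hasValue_const false
  | succ j ih =>
    have h := ((hx j).and (hy j)).or (((hx j).or (hy j)).and ih)
    rw [CARRY, intCarry]
    convert h using 1
    cases a.testBit j <;> cases b.testBit j <;> simp

theorem IntValue.hasValue_sumBit {x y : List (BoolCircuit V)} {a b : ℤ} (hx : IntValue p x a)
    (hy : IntValue p y b) (j : ℕ) : HasValue p (sumBit x y j) ((a + b).testBit j) := by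
  rw [testBit_add]
  exact ((hx j).xor (hy j)).xor (hx.hasValue_CARRY hy j)

theorem NatValue.append_false {x : List (BoolCircuit V)} {n : ℕ} (h : NatValue p x n) :
    IntValue p (x ++ [const false]) n := by
  intro j
  rw [sbit_append_false]
  exact h j

theorem IntValue.map_xor {x : List (BoolCircuit V)} {a : ℤ} {s : BoolCircuit V} {b : Bool}
    (hx : IntValue p x a) (hs : HasValue p s b) (h0 : x ≠ []) :
    IntValue p (x.map fun c => .xor c s) (if b then a.lnot else a) := by
  intro j
  have hbit : sbit (x.map fun c => .xor c s) j = .xor (sbit x j) s := by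
    obtain ⟨m, hm⟩ : ∃ m, x.length = m + 1 :=
      ⟨x.length - 1, by have := List.length_pos_of_ne_nil h0; omega⟩
    rw [map_eq_map_range, hm, sbit_map_range]
    congr 1
    rcases Nat.lt_or_ge j (m + 1) with hj | hj
    · rw [min_eq_left (by omega), ubit, sbit, List.getD_eq_getElem _ _ (by omega),
        List.getD_eq_getElem _ _ (by omega)]
    · rw [min_eq_right (by omega), sbit_eq_sign (by omega), ← sbit_eq_sign (j := m) (by omega),
        ubit, sbit, List.getD_eq_getElem _ _ (by omega), List.getD_eq_getElem _ _ (by omega)]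
  rw [hbit]
  have h := (hx j).xor hs
  cases b
  · simpa using h
  · simpa [Int.testBit_lnot] using h

theorem IntValue.hasValue_sign {x : List (BoolCircuit V)} {a : ℤ} (hx : IntValue p x a) :
    HasValue p (sign x) (decide (a < 0)) := by
  have h := hx (x.length + a.natAbs)
  rw [sbit_eq_sign (by omega)] at h
  convert h using 1
  have hlt : ∀ n l : ℕ, n ≤ l → n.testBit l = false := fun n l h =>
    Nat.testBit_lt_two_pow (lt_of_le_of_lt h Nat.lt_two_pow_self)
  cases a with
  | ofNat n => simp [Int.testBit, hlt n (x.length + n) (by omega)]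
  | negSucc n =>
    simp [Int.testBit, hlt n (x.length + (n + 1)) (by omega)]

theorem intValue_intBits (a : ℤ) : IntValue p (intBits a : List (BoolCircuit V)) a := by
  intro j
  rw [intBits, sbit_map_range]
  convert hasValue_const _ using 1
  have hlt : ∀ n l : ℕ, n.size ≤ l → n.testBit l = false := fun n l h =>
    Nat.testBit_lt_two_pow (Nat.size_le.1 h)
  rcases Nat.lt_or_ge j a.natAbs.size with h | h
  · rw [min_eq_left h.le]
  · rw [min_eq_right h]
    cases a with
    | ofNat n => simp_all [Int.testBit]
    | negSucc n =>
      have hn : n.size ≤ (n + 1).size := Nat.size_le_size (by omega)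
      simp only [Int.natAbs_negSucc, Nat.succ_eq_add_one] at h ⊢
      simp [Int.testBit, hlt n j (hn.trans h), hlt n _ hn]

variable [Fact p.Prime]

theorem IntValue.testBit_eq {x : List (BoolCircuit V)} {a : ℤ} (hx : IntValue p x a) {i j : ℕ}
    (hi : x.length ≤ i + 1) (hj : x.length ≤ j + 1) : a.testBit i = a.testBit j :=
  (hx i).unique (by rw [sbit_eq_sign hi, ← sbit_eq_sign hj]; exact hx j)

theorem IntValue.ADD {x y : List (BoolCircuit V)} {a b : ℤ} (hx : IntValue p x a)
    (hy : IntValue p y b) : IntValue p (ADD x y) (a + b) := by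
  intro j
  rw [ADD_eq, sbit_map_range]
  set m := max x.length y.length with hm
  have hstable : ∀ j, m ≤ j → (a + b).testBit j = (a + b).testBit m := by
    have hcarry : ∀ j, m ≤ j → intCarry a b j = intCarry a b m := by
      intro j hj
      induction j, hj using Nat.le_induction with
      | base => rfl
      | succ j hj ih =>
        rcases Nat.eq_zero_or_pos m with h0 | h0
        · have hx0 : x = [] := List.eq_nil_of_length_eq_zero (by omega)
          have hy0 : y = [] := List.eq_nil_of_length_eq_zero (by omega)
          have ha : a.testBit j = false := (hx j).unique (by rw [hx0]; rfl)
          have hb : b.testBit j = false := (hy j).unique (by rw [hy0]; rfl)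
          rw [intCarry, ha, hb, ih, h0]
          rfl
        · obtain ⟨k, hk⟩ : ∃ k, m = k + 1 := ⟨m - 1, by omega⟩
          rw [intCarry, ih, hx.testBit_eq (i := j) (j := k) (by omega) (by omega),
            hy.testBit_eq (i := j) (j := k) (by omega) (by omega), hk, intCarry]
          cases a.testBit k <;> cases b.testBit k <;> simp
    intro j hj
    rw [testBit_add, testBit_add, hcarry j hj, hx.testBit_eq (i := j) (j := m) (by omega)
      (by omega), hy.testBit_eq (i := j) (j := m) (by omega) (by omega)]
  rcases le_total j m with h | h
  · rw [min_eq_left h]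
    exact hx.hasValue_sumBit hy j
  · rw [min_eq_right h, hstable j h]
    exact hx.hasValue_sumBit hy m

theorem IntValue.natValue {x : List (BoolCircuit V)} {n : ℕ} (h : IntValue p x n) :
    NatValue p x n := by
  intro j
  rcases Nat.lt_or_ge j x.length with hj | hj
  · have := h j
    rwa [sbit, List.getD_eq_getElem _ _ hj, ← List.getD_eq_getElem x (const false) hj] at this
  · rw [ubit_of_le hj]
    have h1 := h.testBit_eq (i := j) (j := j + n) (by omega) (by omega)
    rw [testBit_natCast, testBit_natCast, Nat.testBit_lt_two_pow (i := j + n)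
      (lt_of_lt_of_le Nat.lt_two_pow_self (Nat.pow_le_pow_right (by simp) (by omega)))] at h1
    rw [h1]
    exact hasValue_const false

theorem NatValue.ADDplus {x y : List (BoolCircuit V)} {m n : ℕ} (hx : NatValue p x m)
    (hy : NatValue p y n) : NatValue p (ADDplus x y) (m + n) := by
  intro j
  rcases Nat.lt_or_ge j (max x.length y.length + 1) with hj | hj
  · rw [ADDplus_eq, ubit_map_range _ hj, ← testBit_natCast, Nat.cast_add]
    exact hx.append_false.hasValue_sumBit hy.append_false j
  · rw [ubit_of_le (by rwa [length_ADDplus])]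
    have hlt : ∀ {z : List (BoolCircuit V)} {k l : ℕ}, NatValue p z k → z.length ≤ l →
        k < 2 ^ l := by
      intro z k l hz hl
      refine Nat.lt_pow_two_of_testBit _ fun i hi => ?_
      exact (hz i).unique (by rw [ubit_of_le (by omega)]; exact hasValue_const false)
    have h1 := hlt hx (le_max_left x.length y.length)
    have h2 := hlt hy (le_max_right x.length y.length)
    rw [Nat.testBit_lt_two_pow]
    · exact hasValue_const false
    · calc m + n < 2 ^ (max x.length y.length + 1) := by rw [pow_succ]; omega
        _ ≤ 2 ^ j := Nat.pow_le_pow_right (by simp) hj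

theorem NatValue.PRODplus {x y : List (BoolCircuit V)} {m n : ℕ} (hx : NatValue p x m)
    (hy : NatValue p y n) : NatValue p (PRODplus x y) (m * n) := by
  have key : ∀ i, NatValue p (PRODplusAux x y i) (m * (n % 2 ^ i)) := by
    intro i
    induction i with
    | zero =>
      intro j
      have : ubit (List.replicate x.length (const false : BoolCircuit V)) j = const false := by
        simp [ubit, List.getD_eq_getElem?_getD, List.getElem?_replicate]
        split_ifs <;> rfl
      rw [PRODplusAux, this]
      simpa [Nat.mod_one] using hasValue_const false
    | succ i ih =>
      have hlen := length_PRODplusAux x y i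
      have hdrop : NatValue p ((PRODplusAux x y i).drop i) (m * (n % 2 ^ i) / 2 ^ i) := by
        intro j
        have := ih (j + i)
        rw [Nat.testBit_div_two_pow]
        simpa [ubit, add_comm] using this
      have hmap : NatValue p (x.map fun a => .and a (ubit y i))
          (m * if n.testBit i then 1 else 0) := by
        intro j
        have h := (hx j).and (hy i)
        rcases Nat.lt_or_ge j x.length with hj | hj
        · rw [map_eq_map_range, ubit_map_range _ hj]
          convert h using 1
          cases n.testBit i <;> simp
        · rw [ubit_of_le (by simpa using hj)]
          rw [ubit_of_le hj] at h
          have hm := (hx j).unique (b := false) (by rw [ubit_of_le hj]; exact hasValue_const false)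
          have : (m * if n.testBit i then 1 else 0).testBit j = false := by
            cases n.testBit i <;> simp [hm]
          rw [this]
          exact hasValue_const false
      have hadd := hdrop.ADDplus hmap
      have hval : m * (n % 2 ^ (i + 1)) =
          2 ^ i * (m * (n % 2 ^ i) / 2 ^ i + m * if n.testBit i then 1 else 0) +
            m * (n % 2 ^ i) % 2 ^ i := by
        have h1 : n % 2 ^ (i + 1) = n % 2 ^ i + 2 ^ i * (if n.testBit i then 1 else 0) := by
          rw [← sum_testBit, ← sum_testBit, Finset.sum_range_succ]
        have h2 := Nat.div_add_mod (m * (n % 2 ^ i)) (2 ^ i)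
        rw [h1]
        linear_combination -h2
      intro j
      rw [hval, Nat.testBit_two_pow_mul_add _ (Nat.mod_lt _ (by positivity)), PRODplusAux]
      have htake : ((PRODplusAux x y i).take i).length = i := by simp [hlen]
      by_cases hj : j < i
      · rw [if_pos hj, Nat.testBit_mod_two_pow, decide_eq_true hj, Bool.true_and]
        have := ih j
        rw [ubit, List.getD_append _ _ _ _ (by rwa [htake])]
        simpa [ubit, List.getElem?_take, hj] using this
      · rw [if_neg hj, ubit, List.getD_append_right _ _ _ _ (by rw [htake]; omega), htake]
        exact hadd (j - i)
  have hn : n < 2 ^ y.length := Nat.lt_pow_two_of_testBit _ fun i hi =>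
    (hy i).unique (by rw [ubit_of_le hi]; exact hasValue_const false)
  have := key y.length
  rwa [Nat.mod_eq_of_lt hn] at this

theorem IntValue.NEGIF {x : List (BoolCircuit V)} {a : ℤ} {s : BoolCircuit V} {b : Bool}
    (hx : IntValue p x a) (hs : HasValue p s b) (h0 : x ≠ []) :
    IntValue p (NEGIF s x) (if b then -a else a) := by
  have hone : IntValue p [s, const false] (if b then 1 else 0) := by
    have h : NatValue p [s] (if b then 1 else 0) := by
      intro j
      cases j with
      | zero => cases b <;> simpa [ubit] using hs
      | succ j =>
        rw [ubit_of_le (by simp)]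
        cases b <;> simpa [Nat.testBit_succ] using hasValue_const false
    have := h.append_false
    cases b <;> exact this
  have h := (hx.map_xor hs h0).ADD hone
  rw [BoolCircuit.NEGIF]
  convert h using 1
  rcases b.eq_false_or_eq_true with rfl | rfl
  · cases a with
    | ofNat n => simp [Int.lnot, Int.negSucc_eq]
    | negSucc n => simp [Int.lnot, Int.negSucc_eq]
  · simp

theorem IntValue.ABS {x : List (BoolCircuit V)} {a : ℤ} (hx : IntValue p x a) (h0 : x ≠ []) :
    NatValue p (ABS x) a.natAbs := by
  refine IntValue.natValue ?_
  have h := hx.NEGIF hx.hasValue_sign h0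
  rw [BoolCircuit.ABS]
  convert h using 1
  by_cases ha : a < 0 <;> simp [ha] <;> omega

theorem IntValue.PROD {x y : List (BoolCircuit V)} {a b : ℤ} (hx : IntValue p x a)
    (hy : IntValue p y b) (hx0 : x ≠ []) (hy0 : y ≠ []) : IntValue p (PROD x y) (a * b) := by
  have h := ((hx.ABS hx0).PRODplus (hy.ABS hy0)).append_false.NEGIF
    (hx.hasValue_sign.xor hy.hasValue_sign) (by simp)
  rw [BoolCircuit.PROD]
  convert h using 1
  push_cast
  rcases lt_or_ge a 0 with ha | ha <;> rcases lt_or_ge b 0 with hb | hb <;>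
    simp [ha, hb, abs_of_neg, abs_of_nonneg, not_lt.2]

/-- The constant summand of the subtraction circuit. -/
theorem hasValue_PROD_neg_two_pow (i j : ℕ) :
    HasValue p (sbit (PROD (intBits (-2 ^ i)) (intBits p) : List (BoolCircuit V)) j)
      (!(2 ^ i * p - 1).testBit j) := by
  have h := (intValue_intBits (p := p) (V := V) (-2 ^ i)).PROD (intValue_intBits (p : ℤ))
    (by simp [intBits]) (by simp [intBits]) j
  convert h using 1
  have hp : 0 < p := (Fact.out : p.Prime).pos
  have hpos : 0 < 2 ^ i * p := by positivity
  obtain ⟨m, hm⟩ : ∃ m, 2 ^ i * p = m + 1 := ⟨2 ^ i * p - 1, by omega⟩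
  have : (-2 ^ i * (p : ℤ)) = Int.negSucc m := by
    rw [Int.negSucc_eq, neg_mul]
    exact_mod_cast congrArg (fun n : ℕ => -(n : ℤ)) hm
  rw [this, hm]
  simp [Int.testBit]

end

/-! ## One step of the division by `p` -/

section Comparison

variable {V : Type}

/-- The equivalence of two Boolean circuits. -/
def eqv (a b : BoolCircuit V) : BoolCircuit V := not (xor a b)

/-- If `l` then `a` else `b`. -/
def mux (l a b : BoolCircuit V) : BoolCircuit V := or (and l a) (and (not l) b)

/-- Comparison of two numbers from that of their lower bits and their highest bits `a` and `b`. -/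
def ltStep (a b l : BoolCircuit V) : BoolCircuit V :=
  or (and (not a) b) (and (not (xor a b)) l)

theorem alg_eqv_and (R : Type) [CommRing R] (a b c : BoolCircuit V) :
    (eqv a (and b c)).alg R = 1 - (1 - (1 - a.alg R * (1 - b.alg R * c.alg R)) *
      (1 - (1 - a.alg R) * (b.alg R * c.alg R))) := rfl

theorem ubit_natBits (n j : ℕ) :
    ubit (natBits n.size n : List (BoolCircuit V)) j = const (n.testBit j) := by
  rcases Nat.lt_or_ge j n.size with h | h
  · rw [natBits, ubit_map_range _ h]
  · rw [ubit_of_le (by simpa [natBits] using h), Nat.testBit_lt_two_pow (Nat.size_le.1 h)]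

/-- Comparison of the `i` lowest bits of `x` with those of the constant `n`. -/
def ltConst (x : List (BoolCircuit V)) (n : ℕ) (i : ℕ) : BoolCircuit V :=
  LTaux x (natBits n.size n) i

theorem ltConst_zero (x : List (BoolCircuit V)) (n : ℕ) : ltConst x n 0 = const false := rfl

theorem ltConst_succ (x : List (BoolCircuit V)) (n i : ℕ) :
    ltConst x n (i + 1) = ltStep (ubit x i) (const (n.testBit i)) (ltConst x n i) := by
  rw [ltConst, LTaux, ubit_natBits]
  rfl

theorem LTp_eq_ltConst {p i : ℕ} {x : List (BoolCircuit V)} (h : 2 ^ i * p < 2 ^ x.length) :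
    LTp p i x = ltConst x (2 ^ i * p) x.length := by
  rw [LTp, BoolCircuit.LT, ltConst]
  congr 1
  simpa [natBits] using Nat.size_le.2 h

theorem alg_LTp_of_le {p i : ℕ} {x : List (BoolCircuit V)} (h : 2 ^ x.length ≤ 2 ^ i * p) :
    (LTp p i x).alg (ZMod p) = 1 := by
  have hsize : x.length < (2 ^ i * p).size := by
    by_contra hlt
    exact absurd (Nat.size_le.1 (not_lt.1 hlt)) (not_lt.2 h)
  obtain ⟨k, hk⟩ : ∃ k, (2 ^ i * p).size = k + 1 := ⟨(2 ^ i * p).size - 1, by omega⟩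
  have hbit : (2 ^ i * p).testBit k = true := by
    refine Nat.testBit_of_two_pow_le_and_two_pow_add_one_gt (by
      by_contra hlt
      have := Nat.size_le.2 (not_le.1 hlt)
      omega) ?_
    exact hk ▸ Nat.lt_size_self _
  have heq : LTp p i x = ltConst x (2 ^ i * p) (k + 1) := by
    rw [LTp, BoolCircuit.LT, ltConst]
    congr 1
    simp only [natBits, List.length_map, List.length_range]
    omega
  rw [heq, ltConst_succ, hbit, ubit_of_le (by omega)]
  simp [ltStep, alg]

theorem length_REMstep (p i : ℕ) (x : List (BoolCircuit V)) :
    (REMstep p i x).length = x.length := by simp [REMstep]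

end Comparison

section Bits

theorem decide_mod_two_pow_succ (m j : ℕ) :
    decide (m % 2 ^ (j + 1) ≠ 0) = (decide (m % 2 ^ j ≠ 0) || m.testBit j) := by
  rw [Nat.mod_pow_succ, Nat.testBit_eq_decide_div_mod_eq]
  rcases Nat.mod_two_eq_zero_or_one (m / 2 ^ j) with h | h <;> simp [h]

theorem not_testBit_pred {m : ℕ} (hm : 0 < m) (j : ℕ) :
    (!(m - 1).testBit j) = (m.testBit j ^^ decide (m % 2 ^ j ≠ 0)) := by
  have hdm := Nat.div_add_mod m (2 ^ j)
  have hpos : 0 < 2 ^ j := by positivity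
  have hlt := Nat.mod_lt m hpos
  have hbit : m.testBit j = (m / 2 ^ j).testBit 0 := by
    rw [Nat.testBit_div_two_pow, zero_add]
  by_cases hr : m % 2 ^ j = 0
  · have hq : 0 < m / 2 ^ j := by
      rcases Nat.eq_zero_or_pos (m / 2 ^ j) with h | h
      · rw [h, hr] at hdm; omega
      · exact h
    obtain ⟨q, hq⟩ : ∃ q, m / 2 ^ j = q + 1 := ⟨m / 2 ^ j - 1, by omega⟩
    have hm1 : m - 1 = 2 ^ j * q + (2 ^ j - 1) := by
      rw [hq, hr] at hdm
      have : 2 ^ j * (q + 1) = 2 ^ j * q + 2 ^ j := by ring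
      omega
    rw [hm1, Nat.testBit_two_pow_mul_add _ (by omega), hbit, hq]
    rcases Nat.mod_two_eq_zero_or_one q with h | h <;> simp [hr, Nat.testBit_zero, Nat.add_mod, h]
  · have hm1 : m - 1 = 2 ^ j * (m / 2 ^ j) + (m % 2 ^ j - 1) := by omega
    rw [hm1, Nat.testBit_two_pow_mul_add _ (by omega), hbit]
    simp [hr]

theorem sum_not_testBit_pred {m b : ℕ} (hm : 0 < m) (hb : m < 2 ^ b) :
    ∑ j ∈ Finset.range b, 2 ^ j * (if (!(m - 1).testBit j) then 1 else 0) + m = 2 ^ b := by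
  have h1 := sum_testBit (m - 1) b
  rw [Nat.mod_eq_of_lt (by omega)] at h1
  have h2 : ∑ j ∈ Finset.range b, 2 ^ j * (if (!(m - 1).testBit j) then 1 else 0) +
      ∑ j ∈ Finset.range b, 2 ^ j * (if (m - 1).testBit j then 1 else 0) =
      ∑ j ∈ Finset.range b, 2 ^ j := by
    rw [← Finset.sum_add_distrib]
    refine Finset.sum_congr rfl fun j _ => ?_
    cases (m - 1).testBit j <;> simp
  have h3 := Nat.geomSum_eq (m := 2) le_rfl b
  have : 0 < 2 ^ b := by positivity
  omega

end Bits

/-- The carries of the subtraction of a constant and its result, in terms of a comparison. -/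
theorem exists_subtract : ∃ N : ℕ, ∀ (p : ℕ) [Fact p.Prime] (V : Type) (s : State p V)
    (x y : List (BoolCircuit V)) (m b : ℕ), 0 < m → GoodBits s x →
    (∀ j, HasValue p (sbit y j) (!(m - 1).testBit j)) →
    (∀ j ≤ b, s.Good ((CARRY (x ++ [const false]) y j).alg (ZMod p))) →
    ∃ t, s.Le (N * b) t ∧ (∀ j ≤ b, t.Good ((ltConst x m j).alg (ZMod p))) ∧
      (∀ j < b, Holds t (eqv (sumBit (x ++ [const false]) y j)
        (xor (xor (ubit x j) (const (m.testBit j))) (ltConst x m j)))) ∧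
      Holds t (eqv (CARRY (x ++ [const false]) y b)
        (and (not (ltConst x m b)) (const (decide (m % 2 ^ b ≠ 0))))) := by
  let z : BoolCircuit (Fin 6) := var 0
  let m : BoolCircuit (Fin 6) := var 1
  let ν : BoolCircuit (Fin 6) := var 2
  let β : BoolCircuit (Fin 6) := var 3
  let c : BoolCircuit (Fin 6) := var 4
  let d : BoolCircuit (Fin 6) := var 5
  obtain ⟨N, hN⟩ := exists_entails_circuit [eqv c (and (not β) ν), or (not β) ν, eqv d (xor m ν)]
    [ltStep z m β] [eqv (fullCarry z d c) (and (not (ltStep z m β)) (or ν m)),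
      or (not (ltStep z m β)) (or ν m), eqv (xor (xor z d) c) (xor (xor z m) β)] [] (by decide +kernel)
  refine ⟨N, fun p _ V s x y m b hm hx hy hc => ?_⟩
  suffices h : ∃ t, s.Le (N * b) t ∧ (∀ j ≤ b, t.Good ((ltConst x m j).alg (ZMod p))) ∧
      (∀ j < b, Holds t (eqv (sumBit (x ++ [const false]) y j)
        (xor (xor (ubit x j) (const (m.testBit j))) (ltConst x m j)))) ∧
      Holds t (eqv (CARRY (x ++ [const false]) y b)
        (and (not (ltConst x m b)) (const (decide (m % 2 ^ b ≠ 0))))) ∧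
      Holds t (or (not (ltConst x m b)) (const (decide (m % 2 ^ b ≠ 0)))) by
    obtain ⟨t, ht, h1, h2, h3, -⟩ := h
    exact ⟨t, ht, h1, h2, h3⟩
  refine s.iterate (n := N) b (fun b t => (∀ j ≤ b, t.Good ((ltConst x m j).alg (ZMod p))) ∧
      (∀ j < b, Holds t (eqv (sumBit (x ++ [const false]) y j)
        (xor (xor (ubit x j) (const (m.testBit j))) (ltConst x m j)))) ∧
      Holds t (eqv (CARRY (x ++ [const false]) y b)
        (and (not (ltConst x m b)) (const (decide (m % 2 ^ b ≠ 0))))) ∧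
      Holds t (or (not (ltConst x m b)) (const (decide (m % 2 ^ b ≠ 0))))) ⟨?_, by simp, ?_, ?_⟩ ?_
  · intro j hj
    rw [Nat.le_zero.1 hj]
    exact good_const s false
  · have : (1 - (eqv (CARRY (x ++ [const false]) y 0) (and (not (ltConst x m 0))
        (const (decide (m % 2 ^ 0 ≠ 0))))).alg (ZMod p)) = 0 := by
      simp [eqv, CARRY, BoolCircuit.xor, ltConst_zero, alg, Nat.mod_one]
    rw [Holds, this]
    exact s.zero_zero
  · have : (1 - (or (not (ltConst x m 0))
        (const (decide (m % 2 ^ 0 ≠ 0)))).alg (ZMod p)) = 0 := by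
      simp [ltConst_zero, alg, Nat.mod_one]
    rw [Holds, this]
    exact s.zero_zero
  intro j hj t hst ⟨hβ, hs, hcβ, hβν⟩
  have hd : Holds t (eqv (sbit y j) (xor (const (m.testBit j))
      (const (decide (m % 2 ^ j ≠ 0))))) := by
    have h := ((hy j).xor ((hasValue_const (V := V) (p := p) (m.testBit j)).xor
      (hasValue_const (decide (m % 2 ^ j ≠ 0))))).not
    rw [not_testBit_pred hm, Bool.xor_self] at h
    rw [Holds, eqv, h]
    simpa using t.zero_zero
  obtain ⟨t', ht', hG, hT, -⟩ := hN p V t ![ubit x j, const (m.testBit j),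
      const (decide (m % 2 ^ j ≠ 0)), ltConst x m j, CARRY (x ++ [const false]) y j, sbit y j]
    (by
      intro i
      fin_cases i
      exacts [hst.good (hx.ubit j), good_const t _, good_const t _, hβ j le_rfl,
        hst.good (hc j hj.le), by
          have := t.good_ite (!(m - 1).testBit j)
          rwa [← hy j] at this])
    (List.forall_mem_cons.2 ⟨hcβ, List.forall_mem_cons.2 ⟨hβν, List.forall_mem_cons.2 ⟨hd, by simp⟩⟩⟩)
  have hG1 := (List.forall_mem_cons.1 hG).1
  obtain ⟨hT1, hT⟩ := List.forall_mem_cons.1 hT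
  obtain ⟨hT2, hT⟩ := List.forall_mem_cons.1 hT
  have hT3 := (List.forall_mem_cons.1 hT).1
  have hν : (const (decide (m % 2 ^ (j + 1) ≠ 0)) : BoolCircuit V).alg (ZMod p) =
      (or (const (decide (m % 2 ^ j ≠ 0))) (const (m.testBit j)) : BoolCircuit V).alg
        (ZMod p) := by
    rw [decide_mod_two_pow_succ]
    cases decide (m % 2 ^ j ≠ 0) <;> cases m.testBit j <;> simp [alg]
  refine ⟨t', ht', fun k hk => ?_, fun k hk => ?_, ?_, ?_⟩
  · rcases Nat.le_succ_iff.1 hk with hk | rfl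
    · exact ht'.good (hβ k hk)
    · rw [ltConst_succ]
      exact hG1
  · rcases Nat.lt_succ_iff_lt_or_eq.1 hk with hk | rfl
    · exact ht'.zero (hs k hk)
    · rw [sumBit, sbit_append_false]
      exact hT3
  · rw [ltConst_succ, CARRY, sbit_append_false, Holds, alg_eqv_and, hν]
    exact hT1
  · rw [ltConst_succ, Holds, alg, hν]
    exact hT2

/-- The relation between the comparisons `l : x < m`, `k : x < 2m` and `r : x' < m` of the lowest
bits, where `x'` is `x` if `b` and `x - m` otherwise, and `u` is the highest bit of `2m`. -/
def compareInv {V : Type} (b l u k r : BoolCircuit V) : BoolCircuit V :=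
  and (or (eqv l u) (eqv l k))
    (and (or (not b) (eqv r l)) (or b (eqv r (or (and (not l) u) (and (eqv l u) k)))))

/-- The comparison of a reduced number. -/
theorem exists_compare : ∃ N : ℕ, ∀ (p : ℕ) [Fact p.Prime] (V : Type) (s : State p V)
    (x x' : List (BoolCircuit V)) (S : ℕ → BoolCircuit V) (L : BoolCircuit V) (m b : ℕ),
    GoodBits s x → s.Good (L.alg (ZMod p)) → (∀ j < b, s.Good ((S j).alg (ZMod p))) →
    (∀ j < b, ubit x' j = mux L (ubit x j) (S j)) →
    (∀ j < b, s.Good ((ltConst x m j).alg (ZMod p))) →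
    (∀ j < b, Holds s (eqv (S j)
        (xor (xor (ubit x j) (const (m.testBit j))) (ltConst x m j)))) →
    ∃ t, s.Le (N * b) t ∧ (∀ j < b, t.Good ((ubit x' j).alg (ZMod p))) ∧
      (∀ j < b, t.Zero ((ubit x' j).alg (ZMod p) - L.alg (ZMod p) * (ubit x j).alg (ZMod p) -
        (1 - L.alg (ZMod p)) * (S j).alg (ZMod p))) ∧
      t.Good ((ltConst x (2 * m) b).alg (ZMod p)) ∧ t.Good ((ltConst x' m b).alg (ZMod p)) ∧
      Holds t (compareInv L (ltConst x m b) (const ((2 * m).testBit b)) (ltConst x (2 * m) b)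
        (ltConst x' m b)) := by
  let z : BoolCircuit (Fin 8) := var 0
  let m : BoolCircuit (Fin 8) := var 1
  let μ : BoolCircuit (Fin 8) := var 2
  let σ : BoolCircuit (Fin 8) := var 3
  let β : BoolCircuit (Fin 8) := var 4
  let κ : BoolCircuit (Fin 8) := var 5
  let r : BoolCircuit (Fin 8) := var 6
  let L : BoolCircuit (Fin 8) := var 7
  obtain ⟨N, hN⟩ := exists_entails_circuit [eqv σ (xor (xor z m) β), compareInv L β μ κ r]
    [mux L z σ, ltStep z μ κ, ltStep (mux L z σ) m r]
    [compareInv L (ltStep z m β) m (ltStep z μ κ) (ltStep (mux L z σ) m r)]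
    [[(1, mux L z σ), (-1, and L z), (-1, and (not L) σ)]] (by decide +kernel)
  refine ⟨N, fun p _ V s x x' S L m b hx hL hS hx' hβ hSβ => ?_⟩
  refine s.iterate (n := N) b (fun b t => (∀ j < b, t.Good ((ubit x' j).alg (ZMod p))) ∧
      (∀ j < b, t.Zero ((ubit x' j).alg (ZMod p) - L.alg (ZMod p) * (ubit x j).alg (ZMod p) -
        (1 - L.alg (ZMod p)) * (S j).alg (ZMod p))) ∧
      t.Good ((ltConst x (2 * m) b).alg (ZMod p)) ∧ t.Good ((ltConst x' m b).alg (ZMod p)) ∧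
      Holds t (compareInv L (ltConst x m b) (const ((2 * m).testBit b)) (ltConst x (2 * m) b)
        (ltConst x' m b))) ⟨by simp, by simp, good_const s false, good_const s false, ?_⟩ ?_
  · have h0 : 1 - (compareInv L (ltConst x m 0) (const ((2 * m).testBit 0)) (ltConst x (2 * m) 0)
        (ltConst x' m 0)).alg (ZMod p) = 0 := by
      simp [compareInv, ltConst_zero, eqv, BoolCircuit.xor, alg]
    rw [Holds, h0]
    exact s.zero_zero
  intro j hj t hst ⟨hG, hZ, hκ, hr, hinv⟩
  obtain ⟨t', ht', hG', hT, hZ'⟩ := hN p V t ![ubit x j, const (m.testBit j),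
      const ((2 * m).testBit j), S j, ltConst x m j, ltConst x (2 * m) j, ltConst x' m j, L]
    (by
      intro i
      fin_cases i
      exacts [hst.good (hx.ubit j), good_const t _, good_const t _, hst.good (hS j hj),
        hst.good (hβ j hj), hκ, hr, hst.good hL])
    (List.forall_mem_cons.2 ⟨hst.2 _ (hSβ j hj), List.forall_mem_cons.2 ⟨hinv, by simp⟩⟩)
  obtain ⟨hG1, hG'⟩ := List.forall_mem_cons.1 hG'
  obtain ⟨hG2, hG'⟩ := List.forall_mem_cons.1 hG'
  have hG3 := (List.forall_mem_cons.1 hG').1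
  have hT1 := (List.forall_mem_cons.1 hT).1
  have hZ1 : t'.Zero (((1 : ℤ) : MvPolynomial V (ZMod p)) *
      (mux L (ubit x j) (S j)).alg (ZMod p) + (((-1 : ℤ) : MvPolynomial V (ZMod p)) *
      (L.alg (ZMod p) * (ubit x j).alg (ZMod p)) + (((-1 : ℤ) : MvPolynomial V (ZMod p)) *
      ((1 - L.alg (ZMod p)) * (S j).alg (ZMod p)) + 0))) := (List.forall_mem_cons.1 hZ').1
  have h2m : (2 * m).testBit (j + 1) = m.testBit j := by
    rw [Nat.testBit_succ]
    simp
  refine ⟨t', ht', fun k hk => ?_, fun k hk => ?_, ?_, ?_, ?_⟩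
  · rcases Nat.lt_succ_iff_lt_or_eq.1 hk with hk | rfl
    · exact ht'.good (hG k hk)
    · rw [hx' k hj]
      exact hG1
  · rcases Nat.lt_succ_iff_lt_or_eq.1 hk with hk | rfl
    · exact ht'.zero (hZ k hk)
    · rw [hx' k hj]
      convert hZ1 using 1
      push_cast
      ring
  · rw [ltConst_succ]
    exact hG2
  · rw [ltConst_succ, hx' j hj]
    exact hG3
  · rw [ltConst_succ, ltConst_succ, ltConst_succ, hx' j hj, h2m]
    exact hT1

theorem ubit_REMstep {V : Type} (p i : ℕ) (x : List (BoolCircuit V)) {j : ℕ} (h : j < x.length) :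
    ubit (REMstep p i x) j = mux (LTp p i x) (ubit x j) (sbit (SUBPROD p x i) j) := by
  rw [REMstep, ubit_map_range _ h]
  rfl

theorem sbit_SUBPROD {V : Type} (p i : ℕ) (x : List (BoolCircuit V)) {j : ℕ} (h : j < x.length) :
    sbit (SUBPROD p x i) j =
      sumBit (x ++ [const false]) (PROD (intBits (-2 ^ i)) (intBits p)) j := by
  rw [SUBPROD, ADD_eq, sbit_map_range, min_eq_left]
  simp only [List.length_append, List.length_singleton]
  omega

/-- The final combination of the facts about a subtraction that is made unless `l`. -/
theorem exists_VALp_mux {p : ℕ} [Fact p.Prime] {V : Type} {s : State p V}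
    {l c σ v v' : MvPolynomial V (ZMod p)} {T : ZMod p} (hl : s.Good l)
    (h1 : s.Zero (σ + C T * c - v - C T)) (h2 : s.Zero (c + l - 1))
    (h3 : s.Zero (v' - l * v - (1 - l) * σ)) : ∃ t, s.Le 5 t ∧ t.Zero (v' - v) := by
  obtain ⟨t1, ht1, h4⟩ := s.comp_one.lin hl.1 1 (-1)
  obtain ⟨t2, ht2, h5⟩ := (ht1.zero h1).lin (ht1.zero h2) 1 (-T)
  obtain ⟨t3, ht3, h6⟩ := State.Zero.mul (ht2.comp h4) h5
  have ht := (ht1.trans ht2).trans ht3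
  obtain ⟨t4, ht4, h7⟩ := h6.lin (ht.zero hl.2) 1 (-T)
  obtain ⟨t5, ht5, h8⟩ := h7.lin ((ht.trans ht4).zero h3) 1 1
  refine ⟨t5, (ht.trans ht4).trans ht5, ?_⟩
  convert h8 using 1
  simp only [C_neg, C_1]
  ring

/-- A step of the division by `p` is correct. -/
theorem exists_REMstep : ∃ N : ℕ, ∀ (p : ℕ) [Fact p.Prime] (V : Type) (s : State p V)
    (x : List (BoolCircuit V)) (i : ℕ), GoodBits s x → Holds s (LTp p (i + 1) x) →
    ∃ t, s.Le (N * (x.length + 1)) t ∧ GoodBits t (REMstep p i x) ∧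
      Holds t (LTp p i (REMstep p i x)) ∧ t.Zero (VALp p (REMstep p i x) - VALp p x) := by
  obtain ⟨N1, hN1⟩ := exists_adder
  obtain ⟨N2, hN2⟩ := exists_subtract
  obtain ⟨N3, hN3⟩ := exists_compare
  obtain ⟨N4, hN4⟩ := exists_entails_circuit (k := 4)
    [compareInv (var 0) (var 0) (var 1) (var 2) (var 3), or (var 1) (var 2)] [] [var 3] []
    (by decide +kernel)
  obtain ⟨N5, hN5⟩ := exists_entails_circuit (k := 2)
    [eqv (var 0) (and (not (var 1)) (const true))] [] []
    [[(1, var 0), (1, var 1), (-1, const true)]] (by decide +kernel)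
  refine ⟨N1 + N2 + N3 + N4 + N5 + 6, fun p _ V s x i hx hLT => ?_⟩
  have hp : 0 < p := (Fact.out : p.Prime).pos
  have hm : 0 < 2 ^ i * p := by positivity
  rcases Nat.lt_or_ge (2 ^ i * p) (2 ^ x.length) with hlt | hle
  swap
  · have hbit : ∀ j < x.length,
        (ubit (REMstep p i x) j).alg (ZMod p) = (ubit x j).alg (ZMod p) := by
      intro j hj
      rw [ubit_REMstep _ _ _ hj]
      simp [mux, alg, alg_LTp_of_le hle]
    refine ⟨s, (State.Le.refl s).mono (Nat.zero_le _), ?_, ?_, ?_⟩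
    · rw [REMstep, goodBits_map_range]
      intro j hj
      have h := hbit j hj
      rw [REMstep, ubit_map_range _ hj] at h
      rw [h]
      exact hx.ubit j
    · rw [Holds, alg_LTp_of_le (by rwa [length_REMstep]), sub_self]
      exact s.zero_zero
    · have : VALp p (REMstep p i x) = VALp p x := by
        rw [VALp, VALp, length_REMstep]
        exact Finset.sum_congr rfl fun j hj => by rw [hbit j (Finset.mem_range.1 hj)]
      rw [this, sub_self]
      exact s.zero_zero
  set b := x.length with hb
  set m := 2 ^ i * p with hm_def
  have h2m : 2 ^ (i + 1) * p = 2 * m := by rw [hm_def, pow_succ]; ring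
  set y : List (BoolCircuit V) := PROD (intBits (-2 ^ i)) (intBits p) with hy_def
  have hy : ∀ j, HasValue p (sbit y j) (!(m - 1).testBit j) := hasValue_PROD_neg_two_pow i
  obtain ⟨t1, ht1, hc, hs, hsum⟩ := hN1 p V s (x ++ [const false]) y b
    (fun j _ => by rw [sbit_append_false]; exact hx.ubit j)
    (fun j _ => by rw [hy j]; exact s.good_ite _)
  obtain ⟨t2, ht2, hβ, hsβ, hcβ⟩ := hN2 p V t1 x y m b hm (hx.ext ht1.1) hy hc
  have hLeq : LTp p i x = ltConst x m b := LTp_eq_ltConst hlt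
  obtain ⟨t3, ht3, hG, hmux, hκ, hr, hinv⟩ := hN3 p V t2 x (REMstep p i x)
    (sumBit (x ++ [const false]) y) (ltConst x m b) m b (hx.ext (ht1.trans ht2).1) (hβ b le_rfl)
    (fun j hj => ht2.good (hs j hj))
    (fun j hj => by rw [ubit_REMstep p i x hj, sbit_SUBPROD p i x hj, hLeq])
    (fun j hj => hβ j hj.le) hsβ
  have hμκ : Holds t3 (or (const ((2 * m).testBit b)) (ltConst x (2 * m) b)) := by
    rcases Nat.lt_or_ge (2 * m) (2 ^ b) with h | h
    · rw [LTp_eq_ltConst (by rwa [h2m]), h2m] at hLT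
      rw [Nat.testBit_lt_two_pow h]
      have := ht3.zero (ht2.zero (ht1.zero hLT))
      simpa [Holds, alg] using this
    · rw [Nat.testBit_of_two_pow_le_and_two_pow_add_one_gt h (by rw [pow_succ]; omega)]
      simpa [Holds, alg] using t3.zero_zero
  obtain ⟨t4, ht4, -, hT, -⟩ := hN4 p V t3 ![ltConst x m b, const ((2 * m).testBit b),
      ltConst x (2 * m) b, ltConst (REMstep p i x) m b]
    (by
      intro i
      fin_cases i
      exacts [ht3.good (hβ b le_rfl), good_const t3 _, hκ, hr])
    (List.forall_mem_cons.2 ⟨hinv, List.forall_mem_cons.2 ⟨hμκ, by simp⟩⟩)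
  have hlast : Holds t4 (ltConst (REMstep p i x) m b) := (List.forall_mem_cons.1 hT).1
  rw [decide_eq_true (by rw [Nat.mod_eq_of_lt hlt]; omega : m % 2 ^ b ≠ 0)] at hcβ
  have ht24 := ht3.trans ht4
  obtain ⟨t5, ht5, -, -, hZ⟩ := hN5 p V t4 ![CARRY (x ++ [const false]) y b, ltConst x m b]
    (by
      intro i
      fin_cases i
      exacts [ht24.good (ht2.good (hc b le_rfl)), ht24.good (hβ b le_rfl)])
    (List.forall_mem_cons.2 ⟨ht24.zero hcβ, by simp⟩)
  have hZ1 : t5.Zero (((1 : ℤ) : MvPolynomial V (ZMod p)) *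
      (CARRY (x ++ [const false]) y b).alg (ZMod p) + (((1 : ℤ) : MvPolynomial V (ZMod p)) *
      (ltConst x m b).alg (ZMod p) + (((-1 : ℤ) : MvPolynomial V (ZMod p)) *
      (const true : BoolCircuit V).alg (ZMod p) + 0))) := (List.forall_mem_cons.1 hZ).1
  obtain ⟨t6, ht6, hmuxsum⟩ := t5.zero_sum b (fun j => 2 ^ j) _
    fun j hj => ht5.zero (ht4.zero (hmux j hj))
  have ht25 := ht24.trans ht5
  have hsumy : ∑ j ∈ Finset.range b, C (2 ^ j : ZMod p) * (sbit y j).alg (ZMod p) =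
      (C (2 ^ b) : MvPolynomial V (ZMod p)) := by
    have h := congrArg (Nat.cast : ℕ → MvPolynomial V (ZMod p)) (sum_not_testBit_pred hm hlt)
    have hm0 : (m : MvPolynomial V (ZMod p)) = 0 := by
      rw [hm_def]
      simp
    push_cast at h
    rw [hm0, add_zero] at h
    rw [C_pow, map_ofNat, ← h]
    refine Finset.sum_congr rfl fun j _ => ?_
    rw [hy j, C_pow, map_ofNat]
  obtain ⟨t7, ht7, hfin⟩ := exists_VALp_mux (s := t6) (T := 2 ^ b)
    (l := (ltConst x m b).alg (ZMod p)) (c := (CARRY (x ++ [const false]) y b).alg (ZMod p))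
    (σ := ∑ j ∈ Finset.range b,
      C (2 ^ j : ZMod p) * (sumBit (x ++ [const false]) y j).alg (ZMod p))
    (v := VALp p x) (v' := VALp p (REMstep p i x)) (ht6.good (ht25.good (hβ b le_rfl)))
    (by
      have h := ht6.zero (ht25.zero (ht2.zero hsum))
      convert h using 1
      simp only [mul_add, Finset.sum_add_distrib, hsumy, sbit_append_false]
      rw [VALp]
      ring)
    (by
      have h := ht6.zero hZ1
      convert h using 1
      simp [alg]
      ring)
    (by
      have hmul : ∀ (a : MvPolynomial V (ZMod p)) (f : ℕ → MvPolynomial V (ZMod p)),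
          ∑ j ∈ Finset.range b, C (2 ^ j : ZMod p) * (a * f j) =
            a * ∑ j ∈ Finset.range b, C (2 ^ j : ZMod p) * f j := fun a f => by
        rw [Finset.mul_sum]
        exact Finset.sum_congr rfl fun j _ => mul_left_comm _ _ _
      simp only [mul_sub, Finset.sum_sub_distrib, hmul] at hmuxsum
      rwa [VALp, VALp, length_REMstep, ← hb])
  have ht37 := (ht4.trans ht5).trans (ht6.trans ht7)
  refine ⟨t7, ((ht1.trans ht2).trans (ht3.trans ht37)).mono ?_, ?_, ?_, hfin⟩
  · nlinarith [Nat.zero_le (N4 * b), Nat.zero_le (N5 * b)]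
  · rw [REMstep, goodBits_map_range]
    intro j hj
    have h := ht37.good (hG j hj)
    rwa [REMstep, ubit_map_range _ hj] at h
  · rw [LTp_eq_ltConst (by rwa [length_REMstep]), length_REMstep]
    exact ((ht5.trans ht6).trans ht7).zero hlast

theorem length_REMiter {V : Type} (p : ℕ) (x : List (BoolCircuit V)) (i : ℕ) :
    (REMiter p x i).length = x.length := by
  induction i with
  | zero => rfl
  | succ i ih => rw [REMiter, length_REMstep, ih]

/-- The bits of a number that is less than `p` vanish beyond the length of `p`. -/
theorem exists_high_bits : ∃ N : ℕ, ∀ (p : ℕ) [Fact p.Prime] (V : Type) (s : State p V)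
    (x : List (BoolCircuit V)) (b k : ℕ), GoodBits s x → p.size + k = b →
    Holds s (ltConst x p b) →
    ∃ t, s.Le (N * b) t ∧ ∀ j < k, t.Zero ((ubit x (p.size + j)).alg (ZMod p)) := by
  obtain ⟨N1, hN1⟩ := exists_entails_circuit (k := 3) [] [ltStep (var 0) (var 1) (var 2)] [] []
    (by decide +kernel)
  obtain ⟨N2, hN2⟩ := exists_entails_circuit (k := 2) [ltStep (var 0) (const false) (var 1)] []
    [var 1] [[(1, var 0)]] (by decide +kernel)
  refine ⟨N1 + N2, fun p _ V s x b k hx hb hlt => ?_⟩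
  obtain ⟨t, ht, hG⟩ : ∃ t, s.Le (N1 * b) t ∧ ∀ j ≤ b, t.Good ((ltConst x p j).alg (ZMod p)) := by
    refine s.iterate (n := N1) b (fun b t => ∀ j ≤ b, t.Good ((ltConst x p j).alg (ZMod p))) ?_ ?_
    · intro j hj
      rw [Nat.le_zero.1 hj]
      exact good_const s false
    intro j hj t hst hG
    obtain ⟨t', ht', hG', -, -⟩ := hN1 p V t ![ubit x j, const (p.testBit j), ltConst x p j]
      (by
        intro i
        fin_cases i
        exacts [hst.good (hx.ubit j), good_const t _, hG j le_rfl]) (by simp)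
    refine ⟨t', ht', fun i hi => ?_⟩
    rcases Nat.le_succ_iff.1 hi with hi | rfl
    · exact ht'.good (hG i hi)
    · rw [ltConst_succ]
      exact (List.forall_mem_cons.1 hG').1
  obtain ⟨t', ht', -, hZ⟩ : ∃ t', t.Le (N2 * k) t' ∧ Holds t' (ltConst x p (b - k)) ∧
      ∀ j < k, t'.Zero ((ubit x (b - 1 - j)).alg (ZMod p)) := by
    refine t.iterate (n := N2) k (fun k t => Holds t (ltConst x p (b - k)) ∧
      ∀ j < k, t.Zero ((ubit x (b - 1 - j)).alg (ZMod p))) ⟨ht.zero hlt, by simp⟩ ?_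
    intro j hj t' hst ⟨hlt, hZ⟩
    obtain ⟨c, hc⟩ : ∃ c, b - j = c + 1 := ⟨b - j - 1, by omega⟩
    have hbit : p.testBit c = false :=
      Nat.testBit_lt_two_pow (Nat.size_le.1 (by omega))
    rw [hc, ltConst_succ, hbit] at hlt
    obtain ⟨t'', ht'', -, hT, hZ'⟩ := hN2 p V t' ![ubit x c, ltConst x p c]
      (by
        intro i
        fin_cases i
        exacts [hst.good (ht.good (hx.ubit c)), hst.good (hG c (by omega))])
      (List.forall_mem_cons.2 ⟨hlt, by simp⟩)
    refine ⟨t'', ht'', ?_, fun i hi => ?_⟩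
    · rw [show b - (j + 1) = c by omega]
      exact (List.forall_mem_cons.1 hT).1
    · rcases Nat.lt_succ_iff_lt_or_eq.1 hi with hi | rfl
      · exact ht''.zero (hZ i hi)
      · have h := (List.forall_mem_cons.1 hZ').1
        rw [show b - 1 - i = c by omega]
        simpa [subst] using h
  refine ⟨t', (ht.trans ht').mono ?_, fun j hj => ?_⟩
  · rw [add_mul]
    gcongr
    omega
  · have := hZ (k - 1 - j) (by omega)
    rwa [show b - 1 - (k - 1 - j) = p.size + j by omega] at this

/-- The reduction modulo `p` is correct. -/
theorem exists_REM : ∃ N : ℕ, ∀ (p : ℕ) [Fact p.Prime] (V : Type) (s : State p V)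
    (x : List (BoolCircuit V)), p.size ≤ x.length → GoodBits s x →
    ∃ t, s.Le (N * (x.length + 1) ^ 2) t ∧ GoodBits t (REM p x) ∧
      t.Zero (VALp p (REM p x) - VALp p x) := by
  obtain ⟨N1, hN1⟩ := exists_REMstep
  obtain ⟨N2, hN2⟩ := exists_high_bits
  refine ⟨N1 + N2 + 3, fun p _ V s x hsize hx => ?_⟩
  obtain ⟨k, hk⟩ : ∃ k, p.size + k = x.length := ⟨x.length - p.size, by omega⟩
  obtain ⟨t, ht, hG, hlt, hZ⟩ : ∃ t, s.Le ((N1 * (x.length + 1) + 1) * x.length) t ∧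
      GoodBits t (REMiter p x x.length) ∧
      Holds t (LTp p (x.length - x.length) (REMiter p x x.length)) ∧
      t.Zero (VALp p (REMiter p x x.length) - VALp p x) := by
    refine s.iterate x.length (fun i t => GoodBits t (REMiter p x i) ∧
      Holds t (LTp p (x.length - i) (REMiter p x i)) ∧
      t.Zero (VALp p (REMiter p x i) - VALp p x)) ⟨hx, ?_, ?_⟩ ?_
    · have hp : 0 < p := (Fact.out : p.Prime).pos
      rw [Holds, alg_LTp_of_le, sub_self]
      · exact s.zero_zero
      · exact Nat.le_mul_of_pos_right _ hp
    · simpa [REMiter] using s.zero_zero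
    intro i hi t _ ⟨hG, hlt, hZ⟩
    rw [show x.length - i = x.length - (i + 1) + 1 by omega] at hlt
    obtain ⟨t', ht', hG', hlt', hZ'⟩ := hN1 p V t _ _ hG hlt
    obtain ⟨t'', ht'', h⟩ := hZ'.lin (ht'.zero hZ) 1 1
    rw [length_REMiter] at ht'
    refine ⟨t'', ht'.trans ht'', hG'.ext ht''.1, ht''.zero hlt', ?_⟩
    rw [REMiter]
    simpa using h
  have hp2 : p < 2 ^ x.length := Nat.size_le.1 hsize
  rw [Nat.sub_self, LTp_eq_ltConst (by simpa [length_REMiter] using hp2), length_REMiter, pow_zero,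
    one_mul] at hlt
  obtain ⟨t', ht', hhigh⟩ := hN2 p V t _ _ k hG hk hlt
  obtain ⟨t'', ht'', hsum⟩ := t'.zero_sum k (fun j => 2 ^ (p.size + j)) _ hhigh
  obtain ⟨t3, ht3, h3⟩ := (ht''.zero (ht'.zero hZ)).lin hsum 1 (-1)
  refine ⟨t3, ((ht.trans ht').trans (ht''.trans ht3)).mono ?_, ?_, ?_⟩
  · have : k ≤ x.length := by omega
    nlinarith [Nat.zero_le (N1 * x.length), Nat.zero_le (N2 * x.length),
      Nat.zero_le (x.length ^ 2), Nat.zero_le (N2 * x.length ^ 2)]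
  · rw [REM, goodBits_map_range]
    exact fun j _ => (hG.ext (ht'.trans (ht''.trans ht3)).1).ubit j
  · convert h3 using 1
    rw [VALp_eq_sum p (REMiter p x x.length) (m := p.size + k)
      (by rw [length_REMiter, hk]), Finset.sum_range_add, REM, VALp_map_range]
    simp only [C_neg, C_1]
    ring

/-! ## Bit extraction along the gates of a circuit -/

/-- The polynomial `f` is computed, and certified to be the value of the `p.size` bits `x`. -/
structure Represents {p : ℕ} {V : Type} (s : State p V) (f : MvPolynomial V (ZMod p))
    (x : List (BoolCircuit V)) : Prop where
  good : GoodBits s x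
  length_eq : x.length = p.size
  comp : s.Comp f
  zero : s.Zero (f - VALp p x)

theorem Represents.ext {p : ℕ} {V : Type} {s t : State p V} (h : s.Ext t) {f x}
    (hf : Represents s f x) : Represents t f x :=
  ⟨hf.good.ext h, hf.length_eq, h.1 _ hf.comp, h.2 _ hf.zero⟩

theorem length_REM {V : Type} (p : ℕ) (x : List (BoolCircuit V)) : (REM p x).length = p.size := by
  simp [REM]

theorem VALp_constBits {p : ℕ} [Fact p.Prime] {V : Type} (α : ZMod p) :
    VALp p (constBits p α : List (BoolCircuit V)) = C α := by
  rw [constBits, natBits, VALp_map_range]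
  have h := congrArg (Nat.cast : ℕ → MvPolynomial V (ZMod p)) (sum_testBit α.val p.size)
  rw [Nat.mod_eq_of_lt ((ZMod.val_lt α).trans (Nat.lt_size_self p)), Nat.cast_sum] at h
  rw [← ZMod.natCast_zmod_val α, map_natCast, ← h, ZMod.natCast_zmod_val]
  refine Finset.sum_congr rfl fun j _ => ?_
  rw [C_pow, map_ofNat]
  by_cases hj : α.val.testBit j = true <;> simp [alg, hj]

theorem exists_represents_const {p : ℕ} [Fact p.Prime] {V : Type} (s : State p V) (α : ZMod p) :
    ∃ t, s.Le 1 t ∧ Represents t (C α) (constBits p α) := by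
  obtain ⟨t, ht, h⟩ := s.comp_const α
  refine ⟨t, ht, goodBits_map_range.2 fun _ _ => good_const t _, by simp [constBits, natBits], h, ?_⟩
  rw [VALp_constBits, sub_self]
  exact t.zero_zero

theorem exists_represents_var {p n : ℕ} [Fact p.Prime] (s : State p (Fin n × Fin p.size))
    (i : Fin n) : ∃ t, s.Le (2 * p.size + p.size) t ∧
      Represents t (VALp p (varBits p i)) (varBits p i) := by
  obtain ⟨t, ht, h⟩ := s.iterate_forall (n := 2) p.size
    (fun j t => ∀ hj : j < p.size, t.Good (X (i, ⟨j, hj⟩))) (fun j t t' h hG hj => h.good (hG hj))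
    fun j hj t _ => by
      obtain ⟨t', ht', h⟩ := t.good_var (i, (⟨j, hj⟩ : Fin p.size))
      exact ⟨t', ht', fun _ => h⟩
  have hG : GoodBits t (varBits p i) := by
    intro a ha
    obtain ⟨j, -, rfl⟩ := List.mem_map.1 ha
    exact h j j.2 j.2
  have hlen : (varBits p i).length = p.size := by simp [varBits]
  obtain ⟨t', ht', hc⟩ := hG.comp_VALp
  rw [hlen] at ht'
  refine ⟨t', ht.trans ht', hG.ext ht'.1, hlen, hc, ?_⟩
  rw [sub_self]
  exact t'.zero_zero

theorem exists_represents_add : ∃ N : ℕ, ∀ (p : ℕ) [Fact p.Prime] (V : Type) (s : State p V)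
    (f g : MvPolynomial V (ZMod p)) (x y : List (BoolCircuit V)), Represents s f x →
    Represents s g y → ∃ t, s.Le (N * (p.size + 1) ^ 2) t ∧ Represents t (f + g) (ADDp p x y) := by
  obtain ⟨N1, hN1⟩ := exists_ADDplus
  obtain ⟨N2, hN2⟩ := exists_REM
  refine ⟨N1 + 4 * N2 + 4, fun p _ V s f g x y hf hg => ?_⟩
  obtain ⟨t1, ht1, hG1, hZ1⟩ := hN1 p V s x y hf.good hg.good
  have hlen : (ADDplus x y).length = p.size + 1 := by
    rw [length_ADDplus, hf.length_eq, hg.length_eq, max_self]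
  obtain ⟨t2, ht2, hG2, hZ2⟩ := hN2 p V t1 _ (by omega) hG1
  have ht12 := ht1.trans ht2
  obtain ⟨t3, ht3, h3⟩ := (ht12.comp hf.comp).lin (ht12.comp hg.comp) 1 1
  obtain ⟨t4, ht4, h4⟩ := (ht3.zero (ht12.zero hf.zero)).lin (ht3.zero (ht12.zero hg.zero)) 1 1
  have ht34 := ht3.trans ht4
  obtain ⟨t5, ht5, h5⟩ := (ht34.zero (ht2.zero hZ1)).lin (ht34.zero hZ2) (-1) (-1)
  obtain ⟨t6, ht6, h6⟩ := (ht5.zero h4).lin h5 1 1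
  have ht46 := (ht4.trans ht5).trans ht6
  refine ⟨t6, (ht12.trans (ht3.trans ht46)).mono ?_, hG2.ext (ht3.trans ht46).1,
    length_REM p _, by simpa using ht46.comp h3, ?_⟩
  · rw [hlen, hf.length_eq, hg.length_eq, max_self]
    nlinarith [Nat.zero_le (N1 * p.size), Nat.zero_le (N2 * p.size), Nat.zero_le (p.size ^ 2),
      Nat.zero_le (N1 * p.size ^ 2), Nat.zero_le (N2 * p.size ^ 2)]
  · rw [ADDp]
    convert h6 using 1
    simp only [C_neg, C_1]
    ring

theorem exists_represents_mul : ∃ N : ℕ, ∀ (p : ℕ) [Fact p.Prime] (V : Type) (s : State p V)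
    (f g : MvPolynomial V (ZMod p)) (x y : List (BoolCircuit V)), Represents s f x →
    Represents s g y → ∃ t, s.Le (N * (p.size + 1) ^ 2) t ∧ Represents t (f * g) (PRODp p x y) := by
  obtain ⟨N1, hN1⟩ := exists_PRODplus
  obtain ⟨N2, hN2⟩ := exists_REM
  refine ⟨N1 + 4 * N2 + 7, fun p _ V s f g x y hf hg => ?_⟩
  obtain ⟨t1, ht1, hG1, hZ1⟩ := hN1 p V s x y hf.good hg.good
  have hlen : (PRODplus x y).length = p.size + p.size := by
    rw [length_PRODplus, hf.length_eq, hg.length_eq]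
  obtain ⟨t2, ht2, hG2, hZ2⟩ := hN2 p V t1 _ (by omega) hG1
  have ht12 := ht1.trans ht2
  obtain ⟨t3, ht3, h3⟩ := (ht12.comp hf.comp).mul (ht12.comp hg.comp)
  have ht13 := ht12.trans ht3
  obtain ⟨t4, ht4, h4⟩ := (ht13.comp hf.comp).lin (ht13.zero hf.zero).comp 1 (-1)
  have ht14 := ht13.trans ht4
  obtain ⟨t5, ht5, h5⟩ := State.Zero.mul (ht14.comp hg.comp) (ht14.zero hf.zero)
  obtain ⟨t6, ht6, h6⟩ := State.Zero.mul (ht5.comp h4) (ht5.zero (ht14.zero hg.zero))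
  obtain ⟨t7, ht7, h7⟩ := (ht6.zero h5).lin h6 1 1
  have ht37 := (ht3.trans ht4).trans ((ht5.trans ht6).trans ht7)
  obtain ⟨t8, ht8, h8⟩ := (ht37.zero (ht2.zero hZ1)).lin (ht37.zero hZ2) (-1) (-1)
  obtain ⟨t9, ht9, h9⟩ := (ht8.zero h7).lin h8 1 1
  have ht49 := (ht4.trans ((ht5.trans ht6).trans ht7)).trans (ht8.trans ht9)
  refine ⟨t9, (ht13.trans ht49).mono ?_, hG2.ext (ht3.trans ht49).1,
    length_REM p _, ht49.comp h3, ?_⟩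
  · rw [hlen, hf.length_eq, hg.length_eq]
    nlinarith [Nat.zero_le (N1 * p.size), Nat.zero_le (N2 * p.size), Nat.zero_le (p.size ^ 2),
      Nat.zero_le (N1 * p.size ^ 2), Nat.zero_le (N2 * p.size ^ 2)]
  · rw [PRODp]
    convert h9 using 1
    simp only [C_neg, C_1]
    ring

theorem exists_represents_scale : ∃ N : ℕ, ∀ (p : ℕ) [Fact p.Prime] (V : Type) (s : State p V)
    (α : ZMod p) (f : MvPolynomial V (ZMod p)) (x : List (BoolCircuit V)), Represents s f x →
    ∃ t, s.Le (N * (p.size + 1) ^ 2) t ∧ Represents t (C α * f) (scaleBits p α x) := by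
  obtain ⟨N, hN⟩ := exists_represents_mul
  refine ⟨N + 1, fun p _ V s α f x hf => ?_⟩
  by_cases hα : α = 1
  · refine ⟨s, (State.Le.refl s).mono (Nat.zero_le _), ?_⟩
    rw [scaleBits, if_pos hα, hα, C_1, one_mul]
    exact hf
  · obtain ⟨t, ht, h⟩ := exists_represents_const s α
    obtain ⟨t', ht', h'⟩ := hN p V t _ _ _ _ h (hf.ext ht.1)
    refine ⟨t', (ht.trans ht').mono ?_, ?_⟩
    · have := Nat.one_le_pow 2 (p.size + 1) (by omega)
      linarith
    · rw [scaleBits, if_neg hα]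
      exact h'

theorem exists_represents_lin : ∃ N : ℕ, ∀ (p : ℕ) [Fact p.Prime] (V K : Type) (s : State p V)
    (f : K → MvPolynomial V (ZMod p)) (x : K → List (BoolCircuit V)) (l : List (ZMod p × K)),
    (∀ u, Represents s (f u) (x u)) →
    ∃ t, s.Le (N * (p.size + 1) ^ 2 * (l.length + 1)) t ∧
      Represents t (l.map fun e => C e.1 * f e.2).sum
        (linBits p (l.map fun e => (e.1, x e.2))) := by
  obtain ⟨N1, hN1⟩ := exists_represents_add
  obtain ⟨N2, hN2⟩ := exists_represents_scale
  refine ⟨N1 + N2 + 1, fun p _ V K s f x l hf => ?_⟩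
  induction l with
  | nil =>
    obtain ⟨t, ht, h⟩ := exists_represents_const s (0 : ZMod p)
    exact ⟨t, ht.mono (Nat.succ_le_of_lt (by positivity)), by simpa [linBits] using h⟩
  | cons e l ih =>
    cases l with
    | nil =>
      obtain ⟨t, ht, h⟩ := hN2 p V s e.1 _ _ (hf e.2)
      refine ⟨t, ht.mono ?_, by simpa [linBits] using h⟩
      nlinarith [Nat.zero_le ((N1 + 1) * (p.size + 1) ^ 2), Nat.zero_le (N2 * (p.size + 1) ^ 2)]
    | cons e' l =>
      obtain ⟨t, ht, h⟩ := ih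
      obtain ⟨t1, ht1, h1⟩ := hN2 p V t e.1 _ _ ((hf e.2).ext ht.1)
      obtain ⟨t2, ht2, h2⟩ := hN1 p V t1 _ _ _ _ h1 (h.ext ht1.1)
      refine ⟨t2, (ht.trans (ht1.trans ht2)).mono ?_, ?_⟩
      · rw [List.length_cons (a := e), mul_add _ _ 1]
        nlinarith [Nat.zero_le ((p.size + 1) ^ 2)]
      · rw [List.map_cons, List.sum_cons]
        exact h2

/-- A syntactically constant gate computes a constant. -/
theorem exists_poly_eq_C {p : ℕ} [Fact p.Prime] {V : Type} : ∀ {k : ℕ} (c : Gates (ZMod p) V k),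
    c.Admissible → ∀ u, c.SynConst u → ∃ a, c.poly u = C a
  | _, .nil, _, u, _ => u.elim0
  | _, .snoc c g, hc, u, hu => by
    have ih := exists_poly_eq_C c hc.1
    induction u using Fin.lastCases with
    | cast u =>
      simp only [Gates.SynConst, Fin.snoc_castSucc] at hu
      simpa [Gates.poly] using ih u hu
    | last =>
      simp only [Gates.SynConst, Fin.snoc_last] at hu
      simp only [Gates.poly, Fin.snoc_last]
      cases g with
      | var v => exact hu.elim
      | const a => exact ⟨a, rfl⟩
      | mul u w =>
        obtain ⟨a, ha⟩ := ih u hu.1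
        obtain ⟨b, hb⟩ := ih w hu.2
        exact ⟨a * b, by simp [Gate.poly, ha, hb]⟩
      | lin l =>
        simp only [Gate.SynConst] at hu
        simp only [Gate.poly]
        clear hc
        induction l with
        | nil => exact ⟨0, by simp⟩
        | cons e l ihl =>
          obtain ⟨a, ha⟩ := ih e.2 (hu e (by simp))
          obtain ⟨b, hb⟩ := ihl fun e he => hu e (by simp [he])
          exact ⟨e.1 * a + b, by simp [ha, hb]⟩
      | inv u =>
        obtain ⟨a, ha⟩ := ih u hu
        have hunit : IsUnit (c.poly u) := hc.2.2
        have hcancel := Ring.mul_inverse_cancel _ hunit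
        have ha0 : a ≠ 0 := by
          rintro rfl
          rw [ha, C_0] at hunit
          exact not_isUnit_zero hunit
        refine ⟨a⁻¹, ?_⟩
        rw [Gate.poly]
        calc Ring.inverse (c.poly u) = C (a⁻¹ * a) * Ring.inverse (c.poly u) := by
              rw [inv_mul_cancel₀ ha0, C_1, one_mul]
          _ = C a⁻¹ * (c.poly u * Ring.inverse (c.poly u)) := by rw [C_mul, ← ha, mul_assoc]
          _ = C a⁻¹ := by rw [hcancel, mul_one]

theorem length_le_bitSize_lin {p k : ℕ} {V : Type} (l : List (ZMod p × Fin k)) :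
    l.length + 1 ≤ (Gate.lin l : Gate (ZMod p) V k).bitSize := by
  rw [Gate.bitSize]
  induction l with
  | nil => simp
  | cons e l ih =>
    simp only [List.length_cons, List.map_cons, List.sum_cons]
    omega

/-- The substitution of the value of its bits for each variable. -/
noncomputable def substBits (p n : ℕ) :
    MvPolynomial (Fin n) (ZMod p) →ₐ[ZMod p] MvPolynomial (Fin n × Fin p.size) (ZMod p) :=
  aeval fun i => VALp p (varBits p i)

/-- Every gate of a circuit has the value of its bits. -/
theorem exists_represents_gates : ∃ N : ℕ, ∀ (p : ℕ) [Fact p.Prime] (n k : ℕ)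
    (c : Gates (ZMod p) (Fin n) k), c.Admissible → ∀ s : State p (Fin n × Fin p.size),
    ∃ t, s.Le (N * (p.size + 1) ^ 2 * c.bitSize) t ∧
      ∀ u, Represents t (substBits p n (c.poly u)) (c.BITp u) := by
  obtain ⟨N1, hN1⟩ := exists_represents_mul
  obtain ⟨N2, hN2⟩ := exists_represents_lin
  refine ⟨N1 + N2 + 3, fun p _ n k c hc s => ?_⟩
  induction c with
  | nil => exact ⟨s, by simpa [Gates.bitSize] using State.Le.refl s, fun u => u.elim0⟩
  | snoc c g ih =>
    obtain ⟨t, ht, h⟩ := ih hc.1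
    suffices hg : ∃ t', t.Le ((N1 + N2 + 3) * (p.size + 1) ^ 2 * g.bitSize) t' ∧
        Represents t' (substBits p n (g.poly c.poly)) (g.BITp c.BITp c.poly) by
      obtain ⟨t', ht', hg⟩ := hg
      refine ⟨t', by simpa [Gates.bitSize, mul_add] using ht.trans ht', fun u => ?_⟩
      induction u using Fin.lastCases with
      | cast u => simpa [Gates.poly, Gates.BITp] using (h u).ext ht'.1
      | last => simpa [Gates.poly, Gates.BITp] using hg
    have hmono : ∀ {m r : ℕ} {t' : State p (Fin n × Fin p.size)}, 1 ≤ r →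
        m ≤ (N1 + N2 + 3) * (p.size + 1) ^ 2 → t.Le m t' →
        t.Le ((N1 + N2 + 3) * (p.size + 1) ^ 2 * r) t' :=
      fun hr hm h => h.mono (hm.trans (Nat.le_mul_of_pos_right _ hr))
    have h1 : 1 ≤ (N1 + N2 + 3) * (p.size + 1) ^ 2 :=
      Nat.succ_le_of_lt (by positivity)
    cases g with
    | var i =>
      obtain ⟨t', ht', h'⟩ := exists_represents_var t i
      refine ⟨t', hmono (by simp [Gate.bitSize]) ?_ ht', by
        simpa [substBits, Gate.poly, Gate.BITp] using h'⟩
      nlinarith [Nat.zero_le ((N1 + N2) * (p.size + 1) ^ 2), Nat.zero_le (p.size ^ 2)]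
    | const a =>
      obtain ⟨t', ht', h'⟩ := exists_represents_const t a
      refine ⟨t', hmono (by simp [Gate.bitSize]) h1 ht', ?_⟩
      simpa [Gate.poly, Gate.BITp, ← algebraMap_eq] using h'
    | mul u w =>
      obtain ⟨t', ht', h'⟩ := hN1 p _ t _ _ _ _ (h u) (h w)
      refine ⟨t', hmono (by simp [Gate.bitSize]) (by gcongr; omega) ht', ?_⟩
      simpa [Gate.poly, Gate.BITp] using h'
    | lin l =>
      obtain ⟨t', ht', h'⟩ := hN2 p _ _ t _ _ l h
      refine ⟨t', ht'.mono ?_, ?_⟩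
      · gcongr
        · omega
        · exact length_le_bitSize_lin l
      · rw [Gate.poly, Gate.BITp, map_list_sum, List.map_map]
        rwa [show substBits p n ∘ (fun e : ZMod p × Fin _ => C e.1 * c.poly e.2) =
          fun e => C e.1 * substBits p n (c.poly e.2) by funext e; simp [← algebraMap_eq]]
    | inv u =>
      obtain ⟨a, ha⟩ := exists_poly_eq_C (c.snoc (.inv u)) hc (Fin.last _) (by
        simpa [Gates.SynConst, Gate.SynConst] using hc.2.1)
      have ha' : Ring.inverse (c.poly u) = C a := by simpa [Gates.poly, Gate.poly] using ha
      obtain ⟨t', ht', h'⟩ := exists_represents_const t a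
      refine ⟨t', hmono (by simp [Gate.bitSize]) h1 ht', ?_⟩
      rw [Gate.poly, Gate.BITp, ha', constantCoeff_C]
      simpa [← algebraMap_eq] using h'

/-- The state whose gates are the constants `0` and `1`. -/
def initialState (p : ℕ) (V : Type) : State p V where
  numGates := 2
  gates := (Gates.nil.snoc (.const 0)).snoc (.const 1)
  admissible := by simp [Gates.Admissible, Gate.Admissible]
  exists_zero := ⟨(Fin.last 0).castSucc, by
    rw [Gates.poly, Fin.snoc_castSucc, Gates.poly, Fin.snoc_last]
    simp [Gate.poly]⟩
  exists_one := ⟨Fin.last 1, by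
    rw [Gates.poly, Fin.snoc_last]
    simp [Gate.poly]⟩

theorem bitSize_initialState (p : ℕ) [Fact p.Prime] (V : Type) :
    (initialState p V).gates.bitSize = 3 := by
  have : Fact (1 < p) := ⟨(Fact.out : p.Prime).one_lt⟩
  simp [initialState, Gates.bitSize, Gate.bitSize, ZMod.val_one]

theorem size_le_log_add_one (p : ℕ) : p.size ≤ Nat.log 2 p + 1 :=
  Nat.size_le.2 (Nat.lt_pow_succ_log_self (by norm_num) p)

end BinaryValue

theorem mainTheorem4 :
    ∃ Q : Polynomial ℕ, ∀ (p : ℕ) [Fact p.Prime] (n : ℕ) (F : AlgCircuit (ZMod p) (Fin n)),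
      ∃ P : AlgCircuit (ZMod p) ((Fin n × Fin p.size) ⊕ (Fin n × Fin p.size)),
        IsIPSProof P (boolAxiom (ZMod p) (Fin n × Fin p.size))
          (MvPolynomial.aeval (fun i => BoolCircuit.VALp p (varBits p i)) F.poly
            - BoolCircuit.VALp p F.BITp) ∧
        P.bitSize ≤ Q.eval (F.bitSize + Nat.log 2 p) := by
  obtain ⟨N, hN⟩ := BinaryValue.exists_represents_gates
  refine ⟨3 + Polynomial.C N * (Polynomial.X + 2) ^ 2 * Polynomial.X * (2 * Polynomial.X + 5),
    fun p _ n F => ?_⟩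
  obtain ⟨t, ht, h⟩ := hN p n F.numGates F.gates F.admissible (BinaryValue.initialState p _)
  obtain ⟨u, hu, hu0⟩ := (h F.out).zero
  refine ⟨⟨t.numGates, t.gates, t.admissible, u⟩, ⟨hu, hu0⟩, ?_⟩
  have hsize := BinaryValue.size_le_log_add_one p
  refine ht.2.trans ?_
  rw [BinaryValue.bitSize_initialState]
  simp only [Polynomial.eval_add, Polynomial.eval_mul, Polynomial.eval_pow, Polynomial.eval_C,
    Polynomial.eval_X, Polynomial.eval_ofNat, AlgCircuit.bitSize, BinaryValue.State.gateBound]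
  gcongr ?_ + ?_ * ?_ ^ 2 * ?_ * ?_ <;> omega
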